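/- Let $k\ge 0$, let $\mathcal P$ be a probability distribution on the nonempty boolean constraints on $k$ variables (nonempty subsets of $\{0,1\}^k$), and let $\mathcal C=\mathrm{supp}(\mathcal P)$. A random formula of $SAT_{n,M}(\mathcal P)$ consists of $M$ constraints on the variables $x_1,\dots,x_n$, drawn independently and with repetition; each is a template drawn according to $\mathcal P$ and applied to a uniformly random $k$-element set of variables in a uniformly random order. $SAT(\mathcal P)$ has a *sharp threshold* if there is a function $c(n)$ bounded away from $0$ such that for all $\epsilon>0$ and all $M=M(n)$: if $M(n)<(c(n)-\epsilon)n$ for all large $n$, then $SAT_{n,M}(\mathcal P)$ is satisfiable w.h.p., and if $M(n)>(c(n)+\epsilon)n$ for all large $n$, it is unsatisfiable w.h.p. A clause is an *implicate* of a constraint if every satisfying assignment of the constraint satisfies the clause. In this statement a formula is a finite set of constraints, each of which is a template in $\mathcal C$ applied to $k$ distinct variables. For a formula $F$ let $c^*(F)=\max\{|\mathrm{Constraints}(G)|/|\mathrm{Var}(G)| : \emptyset\ne G\subseteq F\}$. The *spine* of a formula $\Phi$ is the set of variables $x$ for which there are a satisfiable $\Xi\subseteq\Phi$ and a template in $\mathcal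 C$, applied to $k$ distinct variables including $x$, whose addition to $\Xi$ gives an unsatisfiable formula. $SAT(\mathcal P)$ has a *first-order phase transition* if there is $\eta>0$ such that for every sequence $M=M(n)$ of numbers of constraints $$\lim_{n\to\infty}\Pr[\Phi\in SAT]=0\ \Longrightarrow\ \lim_{n\to\infty}\Pr\big[|Spine(\Phi)|/n\ge\eta\big]=1,\qquad \Phi\sim SAT_{n,M(n)}(\mathcal P).$$ The resolution complexity (width) of a formula is the least number of clauses (the least possible maximal clause length) of a resolution refutation of the set of clauses obtained by converting each of its constraints to conjunctive normal form over the same $k$ variables; it is $\infty$ if the formula is satisfiable. **Theorem.** Suppose that $SAT(\mathcal P)$ has a sharp threshold and that no constraint in $\mathcal C$ has a nontautological clause with at most two literals as an implicate. Then: 1. Every minimally unsatisfiable formula $F$ satisfies $c^*(F)\ge \frac{2}{2k-3}$. Consequently there is $\epsilon>0$ such that $c^*(F)>\frac{1+\epsilon}{k-1}$ for every minimally unsatisfiable formula $F$, and $SAT(\mathcal P)$ has a first-order phase transition. 2. For every choice of the conversion to conjunctive normal form and every $c>0$ there is $\delta>0$ such that for every sequence $M(n)\le cn$, w.h.p. as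 $n\to\infty$, a random formula of $SAT_{n,M(n)}(\mathcal P)$ has resolution width at least $\delta n$ and resolution complexity at least $2^{\delta n}$. (The hypotheses can hold only if $k\ge 3$.) -/

import Mathlib

open Filter Topology
open scoped ENNReal

namespace RandomSat

/-! ### Constraints and formulas -/

/-- A nonempty boolean constraint on `k` variables, given by its set of satisfying assignments. -/
abbrev Constraint (k : ℕ) : Type := {S : Finset (Fin k → Bool) // S.Nonempty}

/-- A constraint template applied to an ordered list of `k` distinct variables. -/
abbrev AppliedConstraint (k : ℕ) (V : Type*) : Type _ := Constraint k × (Fin k ↪ V)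

/-- The assignment `a` satisfies the applied constraint `A`. -/
def AppliedConstraint.Holds {k : ℕ} {V : Type*} (A : AppliedConstraint k V) (a : V → Bool) :
    Prop :=
  (fun i => a (A.2 i)) ∈ A.1.1

/-- A (conjunctive) formula, given as a set of applied constraints, is satisfiable. -/
def Satisfiable {k : ℕ} {V : Type*} (F : Set (AppliedConstraint k V)) : Prop :=
  ∃ a : V → Bool, ∀ A ∈ F, A.Holds a

/-- A finite formula is minimally unsatisfiable: it is unsatisfiable, but all its proper
subformulas are satisfiable. -/
def MinimallyUnsatisfiable {k : ℕ} {V : Type*} (F : Finset (AppliedConstraint k V)) : Prop :=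
  ¬ Satisfiable (F : Set (AppliedConstraint k V)) ∧
    ∀ G : Finset (AppliedConstraint k V), G ⊂ F → Satisfiable (G : Set (AppliedConstraint k V))

/-- The variables that appear in a formula. -/
def formulaVars {k : ℕ} {V : Type*} [DecidableEq V] (G : Finset (AppliedConstraint k V)) :
    Finset V :=
  G.biUnion fun A => Finset.univ.map A.2

/-- `c*(F)`, the maximum of the ratio of the number of constraints and the number of variables,
over all nonempty subformulas of `F`. -/
noncomputable def cStar {k : ℕ} {V : Type*} [DecidableEq V]
    (F : Finset (AppliedConstraint k V)) : ℝ :=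
  sSup {r : ℝ | ∃ G : Finset (AppliedConstraint k V), G ⊆ F ∧ G.Nonempty ∧
    r = (G.card : ℝ) / ((formulaVars G).card : ℝ)}

/-! ### Clauses and implicates -/

/-- A clause is a finite set of literals; the literal `(v, b)` says that `v` has value `b`. -/
abbrev Clause (V : Type*) : Type _ := Finset (V × Bool)

/-- The assignment `a` satisfies some literal of the clause. -/
def Clause.Holds {V : Type*} (c : Clause V) (a : V → Bool) : Prop :=
  ∃ l ∈ c, a l.1 = l.2

/-- The clause contains a variable together with its negation. -/
def Clause.Tautological {V : Type*} (c : Clause V) : Prop :=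
  ∃ v : V, (v, true) ∈ c ∧ (v, false) ∈ c

/-- The constraint `C` has a (nontautological) clause with at most `l` literals as an implicate,
i.e. every satisfying assignment of `C` satisfies the clause. -/
def HasImplicateOfLengthAtMost {k : ℕ} (C : Constraint k) (l : ℕ) : Prop :=
  ∃ c : Clause (Fin k), ¬ c.Tautological ∧ c.card ≤ l ∧ ∀ a ∈ C.1, c.Holds a

/-! ### The random model -/

/-- The probability that `m` random constraints, drawn independently and with repetition, are
exactly the sequence `Φ`. Each random constraint consists of a template drawn from `P`, applied
to a uniformly random hyperedge (`k`-element set of the `n` variables) in a uniformly random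
order, that is, to a uniformly random injective `k`-tuple of variables. -/
noncomputable def formulaWeight {k : ℕ} (P : PMF (Constraint k)) {n m : ℕ}
    (Φ : Fin m → AppliedConstraint k (Fin n)) : ℝ :=
  ∏ i, (P (Φ i).1).toReal / (Fintype.card (Fin k ↪ Fin n) : ℝ)

/-- The probability of the event `E` for a random formula with `n` variables and `m`
constraints. -/
noncomputable def prob {k : ℕ} (P : PMF (Constraint k)) (n m : ℕ)
    (E : Set (Fin m → AppliedConstraint k (Fin n))) : ℝ :=
  ∑ Φ, E.indicator (formulaWeight P) Φ

/-- The probability that a random formula with `n` variables and `m` constraints is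
satisfiable. -/
noncomputable def probSat {k : ℕ} (P : PMF (Constraint k)) (n m : ℕ) : ℝ :=
  prob P n m {Φ | Satisfiable (Set.range Φ)}

/-- The random satisfiability problem specified by `P` has a sharp threshold of
satisfiability. -/
def HasSharpThreshold {k : ℕ} (P : PMF (Constraint k)) : Prop :=
  ∃ c : ℕ → ℝ, (∃ a : ℝ, 0 < a ∧ ∀ᶠ n in atTop, a ≤ c n) ∧
    ∀ ε : ℝ, 0 < ε → ∀ M : ℕ → ℕ,
      ((∀ᶠ n : ℕ in atTop, (M n : ℝ) < (c n - ε) * n) →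
        Tendsto (fun n => probSat P n (M n)) atTop (𝓝 1)) ∧
      ((∀ᶠ n : ℕ in atTop, (c n + ε) * n < (M n : ℝ)) →
        Tendsto (fun n => probSat P n (M n)) atTop (𝓝 0))

/-- The spine of a formula: the variables `x` for which there are a satisfiable subformula `Ξ` and
an applied constraint with template in the support of `P`, containing `x`, whose addition makes
`Ξ` unsatisfiable. -/
def spine {k : ℕ} (P : PMF (Constraint k)) {V : Type*} (F : Set (AppliedConstraint k V)) :
    Set V :=
  {x | ∃ Ξ : Set (AppliedConstraint k V), Ξ ⊆ F ∧ Satisfiable Ξ ∧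
    ∃ A : AppliedConstraint k V, A.1 ∈ P.support ∧ x ∈ Set.range A.2 ∧
      ¬ Satisfiable (insert A Ξ)}

/-- A first-order phase transition: for some `η > 0`, whenever random formulas are
unsatisfiable with high probability, their spine contains with high probability at least a
fraction `η` of all variables. -/
def HasFirstOrderPhaseTransition {k : ℕ} (P : PMF (Constraint k)) : Prop :=
  ∃ η : ℝ, 0 < η ∧ ∀ M : ℕ → ℕ,
    Tendsto (fun n => probSat P n (M n)) atTop (𝓝 0) →
    Tendsto (fun n => prob P n (M n)
      {Φ | η ≤ ((spine P (Set.range Φ)).ncard : ℝ) / (n : ℝ)}) atTop (𝓝 1)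

/-! ### Resolution -/

/-- Resolution derivations from the set of clauses `S`. The list holds all the lines of the
derivation, the last derived line being the head of the list. -/
inductive IsDerivation {V : Type*} [DecidableEq V] (S : Set (Clause V)) : List (Clause V) → Prop
  | nil : IsDerivation S []
  | initial {π : List (Clause V)} {c : Clause V} :
      IsDerivation S π → c ∈ S → IsDerivation S (c :: π)
  | resolve {π : List (Clause V)} {c d : Clause V} {x : V} :
      IsDerivation S π → c ∈ π → d ∈ π → (x, true) ∈ c → (x, false) ∈ d →
      IsDerivation S ((c.erase (x, true) ∪ d.erase (x, false)) :: π)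

/-- A refutation is a derivation that contains the empty clause. -/
def IsRefutation {V : Type*} [DecidableEq V] (S : Set (Clause V)) (π : List (Clause V)) : Prop :=
  IsDerivation S π ∧ (∅ : Clause V) ∈ π

/-- The least number of clauses in a resolution refutation (`⊤` if there is none). -/
noncomputable def resolutionComplexity {V : Type*} [DecidableEq V] (S : Set (Clause V)) : ℕ∞ :=
  ⨅ (π : List (Clause V)) (_ : IsRefutation S π), (π.length : ℕ∞)

/-- The least width of a resolution refutation (`⊤` if there is none), the width being the
largest number of literals in a clause of the refutation. -/
noncomputable def resolutionWidth {V : Type*} [DecidableEq V] (S : Set (Clause V)) : ℕ∞ :=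
  ⨅ (π : List (Clause V)) (_ : IsRefutation S π), ⨆ c ∈ π, (c.card : ℕ∞)

/-- `cnf C` is a conjunctive normal form of `C`, for all constraints `C`. -/
def IsCNFConversion {k : ℕ} (cnf : Constraint k → Finset (Clause (Fin k))) : Prop :=
  ∀ (C : Constraint k) (a : Fin k → Bool), a ∈ C.1 ↔ ∀ c ∈ cnf C, c.Holds a

/-- The clauses obtained by converting each constraint of a formula to conjunctive normal form. -/
def cnfClauses {k : ℕ} (cnf : Constraint k → Finset (Clause (Fin k))) {V : Type*}
    (F : Set (AppliedConstraint k V)) : Set (Clause V) :=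
  {d | ∃ A ∈ F, ∃ c ∈ cnf A.1, d = c.map (A.2.prodMap (Function.Embedding.refl Bool))}

end RandomSat

open RandomSat

namespace RandomSat

/-! ### Minimal implications between formulas and clauses -/

/-! Everything rests on one count. If a formula `G` entails a clause `c` and no constraint can be
deleted, then each constraint shares at least three variables with the other constraints or with
`c`. Otherwise its private variables could be reset to satisfy it, since fixing two variables of a
constraint without implicates of length at most two never excludes it. Double counting occurrences
gives |Var(G)| ≤ (k - 3/2)|G| + |c|/2 (`MinEntails.two_mul_card_formulaVars_le`). The case of empty
`c` is the bound on `cStar`.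

Against this, a union bound shows that in random formulas of bounded density every nonempty
subformula with at most σn constraints has more than (k - 5/4)|G| variables w.h.p.
(`exists_prob_not_sparse_le`). The slope 5/4 is chosen between 1, the limit of the union bound, and
3/2 from the count. Combining the two inequalities, a minimal entailment of size at most σn
satisfies |G| < 2|c| (`Sparse.lt_two_mul_card`).

For empty `c` this makes every minimally unsatisfiable subformula linear in size, so it has linearly
many variables, all of them in the spine. When M(n) is superlinear, the argument is run on Dn of the
constraints, which are already unsatisfiable w.h.p. (`exists_prob_satisfiable_le`). The sharp
threshold serves to provide, for each constant assignment, a template rejecting it; this also forces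
k ≥ 3.

For general `c` the inequality says that short clauses needing a number of constraints between s and
2s do not occur, which yields linear width (`Sparse.not_widthDerivable`). The size-width tradeoff
(`IsRefutation.le_length`) turns this into exponential size. -/

/-- Every assignment that satisfies the formula satisfies the clause. -/
def Entails {k : ℕ} {V : Type*} (G : Finset (AppliedConstraint k V)) (c : Clause V) : Prop :=
  ∀ a : V → Bool, (∀ A ∈ G, A.Holds a) → c.Holds a

theorem Entails.mono {k : ℕ} {V : Type*} {G H : Finset (AppliedConstraint k V)} {c d : Clause V}
    (h : Entails G c) (hG : G ⊆ H) (hc : c ⊆ d) : Entails H d := fun a ha => by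
  obtain ⟨l, hl, e⟩ := h a fun A hA => ha A (hG hA)
  exact ⟨l, hc hl, e⟩

theorem entails_empty_iff {k : ℕ} {V : Type*} {G : Finset (AppliedConstraint k V)} :
    Entails G ∅ ↔ ¬ Satisfiable (G : Set (AppliedConstraint k V)) := by
  simp [Entails, Satisfiable, Clause.Holds]

/-- `G` entails `c`, but no formula obtained by deleting a constraint does. -/
def MinEntails {k : ℕ} {V : Type*} [DecidableEq V] (G : Finset (AppliedConstraint k V))
    (c : Clause V) : Prop :=
  Entails G c ∧ ∀ A ∈ G, ¬ Entails (G.erase A) c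

theorem Entails.exists_minEntails {k : ℕ} {V : Type*} [DecidableEq V]
    {G : Finset (AppliedConstraint k V)} {c : Clause V} (h : Entails G c) :
    ∃ H ⊆ G, MinEntails H c := by
  induction G using Finset.strongInduction with
  | H G ih =>
    by_cases hm : ∀ A ∈ G, ¬ Entails (G.erase A) c
    · exact ⟨G, subset_rfl, h, hm⟩
    · push Not at hm
      obtain ⟨A, hA, hA'⟩ := hm
      obtain ⟨H, hH, hH'⟩ := ih _ (Finset.erase_ssubset hA) hA'
      exact ⟨H, hH.trans (Finset.erase_subset _ _), hH'⟩

theorem MinimallyUnsatisfiable.minEntails {k : ℕ} {V : Type*} [DecidableEq V]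
    {F : Finset (AppliedConstraint k V)} (h : MinimallyUnsatisfiable F) : MinEntails F ∅ :=
  ⟨entails_empty_iff.2 h.1, fun _ hA he =>
    entails_empty_iff.1 he (h.2 _ (Finset.erase_ssubset hA))⟩

/-- If no satisfying assignment extended `b` on `T`, the clause saying that some `i ∈ T` has the
value opposite to `b i` would be a nontautological implicate. -/
theorem exists_extension_of_not_hasImplicate {k : ℕ} {C : Constraint k} {l : ℕ}
    (hC : ¬ HasImplicateOfLengthAtMost C l) (T : Finset (Fin k)) (hT : T.card ≤ l)
    (b : Fin k → Bool) : ∃ a ∈ C.1, ∀ i ∈ T, a i = b i := by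
  by_contra! h
  refine hC ⟨T.image fun i => (i, !b i), ?_, Finset.card_image_le.trans hT, fun a ha => ?_⟩
  · rintro ⟨v, h1, h2⟩
    simp only [Finset.mem_image, Prod.mk.injEq] at h1 h2
    obtain ⟨i, -, rfl, h1⟩ := h1
    obtain ⟨j, -, rfl, h2⟩ := h2
    simp_all
  · obtain ⟨i, hi, hne⟩ := h a ha
    refine ⟨(i, !b i), Finset.mem_image_of_mem _ hi, ?_⟩
    simpa using Bool.eq_not_of_ne hne

theorem holds_congr {k : ℕ} {V : Type*} {A : AppliedConstraint k V} {a b : V → Bool}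
    (h : ∀ i, a (A.2 i) = b (A.2 i)) : A.Holds a ↔ A.Holds b := by
  unfold AppliedConstraint.Holds
  rw [funext h]

theorem mem_formulaVars {k : ℕ} {V : Type*} [DecidableEq V] {G : Finset (AppliedConstraint k V)}
    {v : V} : v ∈ formulaVars G ↔ ∃ A ∈ G, ∃ i, A.2 i = v := by
  simp [formulaVars]

/-- In a minimal entailment, every constraint has at least three variables that occur in another
constraint or in the clause. -/
theorem MinEntails.three_le_card {k : ℕ} {V : Type*} [DecidableEq V]
    {G : Finset (AppliedConstraint k V)} {c : Clause V} (h : MinEntails G c)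
    {A : AppliedConstraint k V} (hA : A ∈ G) (himp : ¬ HasImplicateOfLengthAtMost A.1 2) :
    3 ≤ (Finset.univ.filter fun i =>
      A.2 i ∈ formulaVars (G.erase A) ∪ c.image Prod.fst).card := by
  classical
  by_contra! hlt
  have hA' := h.2 A hA
  unfold Entails at hA'
  push Not at hA'
  obtain ⟨a, ha, hc⟩ := hA'
  set U := formulaVars (G.erase A) ∪ c.image Prod.fst with hU
  -- `a` satisfies the other constraints and falsifies `c`. Since at most two positions of `A` are
  -- shared, changing `a` on the private variables of `A` alone also satisfies `A`, which
  -- contradicts the entailment.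
  obtain ⟨b, hb, hab⟩ := exists_extension_of_not_hasImplicate himp _ (Nat.le_of_lt_succ hlt)
    fun i => a (A.2 i)
  let a' : V → Bool := fun v => if v ∈ U then a v else Function.extend A.2 b a v
  have hU' : ∀ v ∈ U, a' v = a v := fun v hv => if_pos hv
  obtain ⟨l, hl, e⟩ := h.1 a' fun B hB => by
    by_cases hBA : B = A
    · subst hBA
      have : (fun i => a' (B.2 i)) = b := by
        funext i
        by_cases hi : B.2 i ∈ U
        · simp [a', hi, hab i (by simpa using hi)]
        · simp [a', hi, B.2.injective.extend_apply]
      unfold AppliedConstraint.Holds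
      rwa [this]
    · have hBG := Finset.mem_erase.2 ⟨hBA, hB⟩
      exact (holds_congr fun i => hU' _ (Finset.mem_union_left _
        (mem_formulaVars.2 ⟨B, hBG, i, rfl⟩))).2 (ha B hBG)
  refine hc ⟨l, hl, ?_⟩
  rw [← e, hU' _ (Finset.mem_union_right _ (Finset.mem_image_of_mem _ hl))]

/-- The number of variables of a minimal entailment is bounded in terms of the number of
constraints and the size of the clause. -/
theorem MinEntails.two_mul_card_formulaVars_le {k : ℕ} {V : Type*} [DecidableEq V]
    {G : Finset (AppliedConstraint k V)} {c : Clause V} (h : MinEntails G c)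
    (himp : ∀ A ∈ G, ¬ HasImplicateOfLengthAtMost A.1 2) :
    2 * (formulaVars G).card + 3 * G.card ≤ 2 * k * G.card + c.card := by
  classical
  let U : AppliedConstraint k V → Finset V := fun A =>
    formulaVars (G.erase A) ∪ c.image Prod.fst
  let vars : AppliedConstraint k V → Finset V := fun A => Finset.univ.map A.2
  have hpriv : ∀ A ∈ G, (vars A).card + (vars A \ U A).card + 3 ≤ 2 * k := by
    intro A hA
    have h3 := h.three_le_card hA (himp A hA)
    have h1 : (vars A).card = k := by simp [vars]
    have h2 : (vars A ∩ U A).card = (Finset.univ.filter fun i => A.2 i ∈ U A).card := by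
      rw [← Finset.card_map A.2]
      congr 1
      ext v
      simp only [vars, Finset.mem_inter, Finset.mem_map, Finset.mem_univ, true_and,
        Finset.mem_filter]
      constructor
      · rintro ⟨⟨i, rfl⟩, h⟩
        exact ⟨i, h, rfl⟩
      · rintro ⟨i, h, rfl⟩
        exact ⟨⟨i, rfl⟩, h⟩
    have h4 := Finset.card_sdiff_add_card_inter (vars A) (U A)
    simp only [U] at h2 h4 ⊢
    omega
  -- Private variables are counted twice in their constraint, so every variable receives weight at
  -- least 2: from two constraints, from one constraint and the clause, or from its private double
  -- count.
  have hv : ∀ v ∈ formulaVars G, 2 ≤ (∑ A ∈ G, ((if v ∈ vars A then 1 else 0) +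
      (if v ∈ vars A \ U A then 1 else 0))) + if v ∈ c.image Prod.fst then 1 else 0 := by
    intro v hv
    obtain ⟨A, hA, i, rfl⟩ := mem_formulaVars.1 hv
    have hvA : A.2 i ∈ vars A := by simp [vars]
    rw [← Finset.add_sum_erase _ _ hA, if_pos hvA]
    by_cases hU : A.2 i ∈ U A
    · rcases Finset.mem_union.1 hU with hU | hU
      · obtain ⟨B, hB, j, hj⟩ := mem_formulaVars.1 hU
        have := Finset.single_le_sum (f := fun B => (if A.2 i ∈ vars B then 1 else 0) +
          (if A.2 i ∈ vars B \ U B then 1 else 0)) (fun _ _ => Nat.zero_le _) hB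
        have hB' : A.2 i ∈ vars B := by simp [vars, ← hj]
        simp only [if_pos hB'] at this
        omega
      · rw [if_pos hU]
        omega
    · rw [if_pos (Finset.mem_sdiff.2 ⟨hvA, hU⟩)]
      omega
  have hsum := Finset.sum_le_sum hv
  rw [Finset.sum_add_distrib, Finset.sum_comm] at hsum
  have h1 : ∑ A ∈ G, ∑ v ∈ formulaVars G, ((if v ∈ vars A then 1 else 0) +
      (if v ∈ vars A \ U A then 1 else 0)) + 3 * G.card ≤ 2 * k * G.card := by
    have : ∑ A ∈ G, (∑ v ∈ formulaVars G, ((if v ∈ vars A then 1 else 0) +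
      (if v ∈ vars A \ U A then 1 else 0)) + 3) ≤ ∑ A ∈ G, 2 * k := by
      refine Finset.sum_le_sum fun A hA => le_trans ?_ (hpriv A hA)
      rw [Finset.sum_add_distrib, Finset.sum_boole, Finset.sum_boole]
      simp only [Nat.cast_id]
      gcongr <;> exact fun v hv => (Finset.mem_filter.1 hv).2
    rw [Finset.sum_add_distrib] at this
    simp only [Finset.sum_const, smul_eq_mul] at this
    linarith
  have h2 : ∑ v ∈ formulaVars G, (if v ∈ c.image Prod.fst then 1 else 0) ≤ c.card := by
    rw [Finset.sum_boole]
    refine le_trans (Finset.card_le_card (t := c.image Prod.fst) fun v => ?_)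
      Finset.card_image_le
    simp
  simp only [Finset.sum_const, smul_eq_mul] at hsum
  omega

theorem MinEntails.nonempty {k : ℕ} {V : Type*} [DecidableEq V]
    {G : Finset (AppliedConstraint k V)} (h : MinEntails G ∅) : G.Nonempty := by
  by_contra hG
  rw [Finset.not_nonempty_iff_eq_empty] at hG
  subst hG
  exact entails_empty_iff.1 h.1 ⟨fun _ => true, by simp⟩

theorem MinEntails.three_le {k : ℕ} {V : Type*} [DecidableEq V]
    {G : Finset (AppliedConstraint k V)} (h : MinEntails G ∅)
    (himp : ∀ A ∈ G, ¬ HasImplicateOfLengthAtMost A.1 2) : 3 ≤ k := by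
  obtain ⟨A, hA⟩ := h.nonempty
  simpa using (h.three_le_card hA (himp A hA)).trans (Finset.card_le_univ _)

theorem card_div_card_le_cStar {k : ℕ} {V : Type*} [DecidableEq V]
    {F G : Finset (AppliedConstraint k V)} (hG : G ⊆ F) (hne : G.Nonempty) :
    (G.card : ℝ) / ((formulaVars G).card : ℝ) ≤ cStar F := by
  refine le_csSup ?_ ⟨G, hG, hne, rfl⟩
  refine (Set.Finite.subset (F.powerset.finite_toSet.image
    fun G => (G.card : ℝ) / ((formulaVars G).card : ℝ)) ?_).bddAbove
  rintro r ⟨G, hG, -, rfl⟩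
  exact ⟨G, by simpa using hG, rfl⟩

theorem le_cStar_of_minimallyUnsatisfiable {k : ℕ} {V : Type*} [DecidableEq V]
    {F : Finset (AppliedConstraint k V)} (hF : MinimallyUnsatisfiable F)
    (himp : ∀ A ∈ F, ¬ HasImplicateOfLengthAtMost A.1 2) :
    2 / (2 * (k : ℝ) - 3) ≤ cStar F := by
  have hm := hF.minEntails
  have hk : (3 : ℝ) ≤ k := by exact_mod_cast hm.three_le himp
  obtain ⟨A, hA⟩ := hm.nonempty
  have hv : 0 < (formulaVars F).card := Finset.card_pos.2
    ⟨A.2 ⟨0, by have := hm.three_le himp; omega⟩, mem_formulaVars.2 ⟨A, hA, _, rfl⟩⟩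
  have hv' : (0 : ℝ) < (formulaVars F).card := by exact_mod_cast hv
  refine le_trans ?_ (card_div_card_le_cStar subset_rfl hm.nonempty)
  rw [div_le_div_iff₀ (by linarith) hv']
  have := hm.two_mul_card_formulaVars_le himp
  have : (2 * (formulaVars F).card + 3 * F.card : ℝ) ≤ 2 * k * F.card := by
    exact_mod_cast this
  linarith

theorem lt_cStar_of_minimallyUnsatisfiable {k : ℕ} {V : Type*} [DecidableEq V]
    {F : Finset (AppliedConstraint k V)} (hF : MinimallyUnsatisfiable F)
    (himp : ∀ A ∈ F, ¬ HasImplicateOfLengthAtMost A.1 2) :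
    (1 + 1 / (2 * (k : ℝ) + 1)) / ((k : ℝ) - 1) < cStar F := by
  have hk : (3 : ℝ) ≤ k := by exact_mod_cast hF.minEntails.three_le himp
  refine lt_of_lt_of_le ?_ (le_cStar_of_minimallyUnsatisfiable hF himp)
  rw [div_lt_div_iff₀ (by linarith) (by linarith)]
  -- Any ε < 1/(2k - 3) would do; the denominator 2k + 1 is positive for every k.
  have : 1 / (2 * (k : ℝ) + 1) * (2 * k - 3) < 1 := by
    rw [one_div, inv_mul_lt_one₀ (by linarith)]
    linarith
  linarith

/-! ### Resolution derivations of bounded width -/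

/-- Clauses derivable from `S` by resolution with weakening, when the literals of `τ` are set to
false; all conclusions of a resolution step have at most `w` literals outside `τ`. -/
inductive WidthDerivable {V : Type*} [DecidableEq V] (S : Set (Clause V)) (τ : Clause V) (w : ℕ) :
    Clause V → Prop
  | initial {c : Clause V} : c ∈ S → WidthDerivable S τ w c
  | tautology {c : Clause V} : c.Tautological → WidthDerivable S τ w c
  | weaken {c d : Clause V} : WidthDerivable S τ w c → c ⊆ d → WidthDerivable S τ w d
  | cut {c : Clause V} (x : V) : (c \ τ).card ≤ w → WidthDerivable S τ w (insert (x, true) c) →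
      WidthDerivable S τ w (insert (x, false) c) → WidthDerivable S τ w c

section Width

variable {V : Type*} [DecidableEq V] {S : Set (Clause V)} {τ : Clause V} {w : ℕ}

theorem WidthDerivable.cut_literal {c : Clause V} (l : V × Bool) (hc : (c \ τ).card ≤ w)
    (h1 : WidthDerivable S τ w (insert l c))
    (h2 : WidthDerivable S τ w (insert (l.1, !l.2) c)) : WidthDerivable S τ w c := by
  obtain ⟨x, _ | _⟩ := l
  · exact .cut x hc h2 h1
  · exact .cut x hc h1 h2

theorem WidthDerivable.mono_width {w' : ℕ} (hw : w ≤ w') {c : Clause V}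
    (h : WidthDerivable S τ w c) : WidthDerivable S τ w' c := by
  induction h with
  | initial h => exact .initial h
  | tautology h => exact .tautology h
  | weaken _ h ih => exact .weaken ih h
  | cut x h _ _ ih1 ih2 => exact .cut x (h.trans hw) ih1 ih2

/-- Lifting the restriction on `l` makes at most one more literal count in each clause. -/
theorem WidthDerivable.of_insert {l : V × Bool} {c : Clause V}
    (h : WidthDerivable S (insert l τ) w c) : WidthDerivable S τ (w + 1) c := by
  induction h with
  | initial h => exact .initial h
  | tautology h => exact .tautology h
  | weaken _ h ih => exact .weaken ih h
  | @cut c x h _ _ ih1 ih2 =>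
    refine .cut x ?_ ih1 ih2
    have : c \ τ ⊆ insert l (c \ insert l τ) := by
      intro m hm
      by_cases hml : m = l <;> simp_all
    exact (Finset.card_le_card this).trans ((Finset.card_insert_le _ _).trans (by omega))

/-- A derivation that sets the literal `l` to false becomes a derivation without that restriction,
if the negation of `l` is derivable. -/
theorem WidthDerivable.erase_union {l : V × Bool} (hS : ∀ c ∈ S, c.card ≤ w)
    (hl : WidthDerivable S τ w (insert (l.1, !l.2) τ)) {c : Clause V}
    (h : WidthDerivable S (insert l τ) w c) : WidthDerivable S τ w (c.erase l ∪ τ) := by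
  induction h with
  | @initial c hc =>
    -- The literal `l` is removed already at the initial clauses, by a cut with the negation of `l`;
    -- later lines then never carry it, so the width does not grow.
    refine .cut_literal l ?_ (.weaken (.initial hc) ?_) (.weaken hl ?_)
    · refine (Finset.card_le_card fun m hm => ?_).trans (hS c hc)
      simp only [Finset.mem_sdiff, Finset.mem_union, Finset.mem_erase] at hm
      tauto
    · intro m hm
      by_cases hml : m = l <;> simp [hml, hm]
    · exact Finset.insert_subset_insert _ Finset.subset_union_right
  | @tautology c hc =>
    obtain ⟨v, h1, h2⟩ := hc
    by_cases hv : v = l.1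
    · refine hl.weaken (Finset.insert_subset ?_ Finset.subset_union_right)
      refine Finset.mem_union_left _ (Finset.mem_erase.2 ⟨?_, ?_⟩)
      · intro e
        have := congrArg Prod.snd e
        simp at this
      · rw [← hv]
        cases l.2 <;> assumption
    · refine .tautology ⟨v, ?_, ?_⟩ <;>
      · refine Finset.mem_union_left _ (Finset.mem_erase.2 ⟨?_, by assumption⟩)
        rintro rfl
        exact hv rfl
  | weaken _ h ih =>
    exact ih.weaken (Finset.union_subset_union_left (Finset.erase_subset_erase _ h))
  | @cut c x h _ _ ih1 ih2 =>
    refine .cut x ?_ (ih1.weaken ?_) (ih2.weaken ?_)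
    · refine (Finset.card_le_card fun m hm => ?_).trans h
      simp only [Finset.mem_sdiff, Finset.mem_union, Finset.mem_erase, Finset.mem_insert] at hm ⊢
      tauto
    all_goals
      intro m hm
      simp only [Finset.mem_union, Finset.mem_erase, Finset.mem_insert] at hm ⊢
      tauto

/-! ### The size-width tradeoff by restrictions -/

/-- A clause is wide under the restriction that sets the literals of `τ` to false. -/
def Wide (τ : Clause V) (d : ℕ) (c : Clause V) : Prop :=
  ¬ (c ∪ τ).Tautological ∧ d < (c \ τ).card

/-- A line that is not wide is either tautological together with `τ`, hence free, or short enough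
outside `τ` to be the conclusion of a cut. -/
theorem IsDerivation.widthDerivable_union {π : List (Clause V)} (hπ : IsDerivation S π) {d : ℕ}
    (hd : ∀ c ∈ π, ¬ Wide τ d c) : ∀ c ∈ π, WidthDerivable S τ d (c ∪ τ) := by
  induction hπ with
  | nil => simp
  | @initial π c _ hc ih =>
    intro e he
    rcases List.mem_cons.1 he with rfl | he
    · exact (WidthDerivable.initial hc).weaken Finset.subset_union_left
    · exact ih (fun c hc => hd c (List.mem_cons_of_mem _ hc)) e he
  | @resolve π c₁ c₂ x _ h1 h2 hx1 hx2 ih =>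
    have ih := ih fun c hc => hd c (List.mem_cons_of_mem _ hc)
    intro e he
    rcases List.mem_cons.1 he with rfl | he
    · have hw := hd _ List.mem_cons_self
      by_cases ht : Clause.Tautological
          ((c₁.erase (x, true) ∪ c₂.erase (x, false)) ∪ τ)
      · exact .tautology ht
      refine .cut x ?_ ((ih _ h1).weaken ?_) ((ih _ h2).weaken ?_)
      · rw [Finset.union_sdiff_right]
        exact not_lt.1 fun h => hw ⟨ht, h⟩
      · intro m hm
        simp only [Finset.mem_union, Finset.mem_erase, Finset.mem_insert] at hm ⊢
        tauto
      · intro m hm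
        simp only [Finset.mem_union, Finset.mem_erase, Finset.mem_insert] at hm ⊢
        tauto
    · exact ih e he

theorem IsRefutation.widthDerivable_self {π : List (Clause V)} (hπ : IsRefutation S π) {d : ℕ}
    (hd : ∀ c ∈ π, ¬ Wide τ d c) : WidthDerivable S τ d τ := by
  simpa using hπ.1.widthDerivable_union hd ∅ hπ.2

theorem Wide.of_insert {l : V × Bool} {d : ℕ} {c : Clause V} (h : Wide (insert l τ) d c) :
    Wide τ d c := by
  refine ⟨fun ⟨v, h1, h2⟩ => h.1 ⟨v, ?_, ?_⟩, h.2.trans_le (Finset.card_le_card ?_)⟩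
  · simp only [Finset.mem_union, Finset.mem_insert] at h1 ⊢; tauto
  · simp only [Finset.mem_union, Finset.mem_insert] at h2 ⊢; tauto
  · exact Finset.sdiff_subset_sdiff subset_rfl (Finset.subset_insert _ _)

theorem not_wide_insert_neg {l : V × Bool} {d : ℕ} {c : Clause V} (hl : l ∈ c) :
    ¬ Wide (insert (l.1, !l.2) τ) d c := by
  rintro ⟨h, -⟩
  refine h ⟨l.1, ?_, ?_⟩ <;> obtain ⟨x, _ | _⟩ := l <;> simp [hl]

open Classical in
/-- Some literal outside `τ` occurs in the average proportion of the wide clauses. -/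
theorem exists_popular_literal [Fintype V] {d : ℕ} (C : Finset (Clause V))
    (hC : ∀ c ∈ C, Wide τ d c) (hne : C.Nonempty) :
    ∃ l : V × Bool, l ∉ τ ∧
      d * C.card ≤ 2 * Fintype.card V * (C.filter fun c => l ∈ c).card := by
  by_contra! h
  have h1 : ∑ c ∈ C, (c \ τ).card = ∑ l ∈ Finset.univ \ τ, (C.filter fun c => l ∈ c).card := by
    have : ∀ c : Clause V, (c \ τ).card = ∑ l ∈ Finset.univ \ τ, if l ∈ c then 1 else 0 := by
      intro c
      rw [Finset.sum_boole]
      simp only [Nat.cast_id]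
      congr 1
      ext l
      simp [and_comm]
    simp only [this, Finset.card_filter]
    rw [Finset.sum_comm]
  have h2 : C.card * (d + 1) ≤ ∑ c ∈ C, (c \ τ).card :=
    Finset.card_nsmul_le_sum C (fun c => (c \ τ).card) (d + 1) fun c hc => (hC c hc).2
  have h3 : ∑ l ∈ Finset.univ \ τ, 2 * Fintype.card V * (C.filter fun c => l ∈ c).card ≤
      (Finset.univ \ τ).card * (d * C.card) :=
    Finset.sum_le_card_nsmul _ _ _ fun l hl => (h l (Finset.mem_sdiff.1 hl).2).le
  rw [← Finset.mul_sum, ← h1] at h3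
  have h4 : (Finset.univ \ τ).card ≤ 2 * Fintype.card V := by
    refine (Finset.card_le_univ _).trans ?_
    simp [mul_comm]
  have h5 : 0 < Fintype.card V := by
    obtain ⟨c, hc⟩ := hne
    obtain ⟨l, -⟩ := Finset.card_pos.1 (Nat.zero_lt_of_lt (hC c hc).2)
    exact Fintype.card_pos_iff.2 ⟨l.1⟩
  have h6 := h3.trans (Nat.mul_le_mul_right _ h4)
  have h7 := Nat.le_of_mul_le_mul_left h6 (by omega)
  have := hne.card_pos
  nlinarith

open Classical in
/-- A refutation with few wide clauses yields a refutation of small width. -/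
theorem IsRefutation.widthDerivable [Fintype V] {π : List (Clause V)} (hπ : IsRefutation S π)
    {d : ℕ} (hS : ∀ c ∈ S, c.card ≤ d) (hV : 0 < Fintype.card V) (hd : d ≤ 2 * Fintype.card V)
    (b : ℕ) (τ : Clause V)
    (h : ((π.toFinset.filter (Wide τ d)).card : ℝ) *
      (1 - d / (2 * Fintype.card V)) ^ b < 1) : WidthDerivable S τ (d + b) τ := by
  have hV' : (0 : ℝ) < 2 * Fintype.card V := by exact_mod_cast Nat.mul_pos two_pos hV
  have hq : (0 : ℝ) ≤ 1 - d / (2 * Fintype.card V) := by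
    rw [sub_nonneg, div_le_one hV']
    exact_mod_cast hd
  induction b generalizing τ with
  | zero =>
    refine hπ.widthDerivable_self fun c hc hw => ?_
    have : 0 < (π.toFinset.filter (Wide τ d)).card :=
      Finset.card_pos.2 ⟨c, Finset.mem_filter.2 ⟨List.mem_toFinset.2 hc, hw⟩⟩
    have : (1 : ℝ) ≤ (π.toFinset.filter (Wide τ d)).card := by exact_mod_cast this
    linarith
  | succ b ihb =>
    -- For a popular literal `l`, making it true removes all clauses containing it and lowers `b`;
    -- making it false keeps `b` but leaves fewer free literals. The inner induction handles the
    -- second branch.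
    induction hm : (Finset.univ \ τ).card using Nat.strong_induction_on generalizing τ with
    | _ m ihm =>
      set C := π.toFinset.filter (Wide τ d) with hC
      by_cases hne : C.Nonempty
      · obtain ⟨l, hlτ, hl⟩ := exists_popular_literal C
          (fun c hc => (Finset.mem_filter.1 hc).2) hne
        have h1 : WidthDerivable S τ (d + (b + 1)) (insert (l.1, !l.2) τ) := by
          -- The number of wide clauses drops by the factor 1 - d/(2|V|), and the unit of width
          -- saved in `b` is spent on lifting the restriction.
          refine (ihb _ (lt_of_le_of_lt ?_ h)).of_insert
          rw [pow_succ', ← mul_assoc]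
          refine mul_le_mul_of_nonneg_right ?_ (pow_nonneg hq b)
          have h2 : (π.toFinset.filter (Wide (insert (l.1, !l.2) τ) d)).card +
              (C.filter fun c => l ∈ c).card ≤ C.card := by
            rw [← Finset.card_union_of_disjoint]
            · refine Finset.card_le_card (Finset.union_subset (fun c hc => ?_)
                (Finset.filter_subset _ _))
              rw [Finset.mem_filter] at hc
              exact Finset.mem_filter.2 ⟨hc.1, hc.2.of_insert⟩
            · rw [Finset.disjoint_left]
              intro c hc hc'
              exact not_wide_insert_neg (Finset.mem_filter.1 hc').2 (Finset.mem_filter.1 hc).2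
          have h2' : ((π.toFinset.filter (Wide (insert (l.1, !l.2) τ) d)).card : ℝ) +
              (C.filter fun c => l ∈ c).card ≤ C.card := by exact_mod_cast h2
          have h3 : (d : ℝ) * C.card ≤
              2 * Fintype.card V * (C.filter fun c => l ∈ c).card := by exact_mod_cast hl
          have h4 : (d : ℝ) / (2 * Fintype.card V) * C.card ≤
              (C.filter fun c => l ∈ c).card := by
            rw [div_mul_eq_mul_div, div_le_iff₀ hV']
            linarith
          linarith
        have h2 : WidthDerivable S (insert l τ) (d + (b + 1)) (insert l τ) := by
          refine ihm _ ?_ _ (lt_of_le_of_lt ?_ h) rfl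
          · rw [← hm]
            refine Finset.card_lt_card ⟨Finset.sdiff_subset_sdiff subset_rfl
              (Finset.subset_insert _ _), fun hs => ?_⟩
            have := @hs l (by simp [hlτ])
            simp at this
          · refine mul_le_mul_of_nonneg_right ?_ (pow_nonneg hq _)
            gcongr
            intro c hc
            rw [Finset.mem_filter] at hc
            exact Finset.mem_filter.2 ⟨hc.1, hc.2.of_insert⟩
        refine (h1.erase_union (fun c hc => (hS c hc).trans (by omega)) h2).weaken ?_
        intro m hm
        simp only [Finset.mem_union, Finset.mem_erase, Finset.mem_insert] at hm
        tauto
      · refine (hπ.widthDerivable_self fun c hc hw => hne ⟨c, ?_⟩).mono_width (Nat.le_add_right _ _)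
        simp [hC, hc, hw]

/-- A refutation of width at most `w`. -/
theorem IsRefutation.widthDerivable_of_card_le {π : List (Clause V)} (hπ : IsRefutation S π)
    (hw : ∀ c ∈ π, c.card ≤ w) : WidthDerivable S ∅ w ∅ :=
  hπ.widthDerivable_self fun c hc h => by
    have := h.2
    simp only [Finset.sdiff_empty] at this
    exact absurd (hw c hc) (by omega)

/-- The size-width tradeoff. -/
theorem IsRefutation.le_length [Fintype V] {π : List (Clause V)} (hπ : IsRefutation S π)
    {d b : ℕ} (hS : ∀ c ∈ S, c.card ≤ d) (hV : 0 < Fintype.card V)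
    (hd : d ≤ 2 * Fintype.card V) (hw : ¬ WidthDerivable S ∅ (d + b) ∅) :
    Real.exp (d * b / (2 * Fintype.card V)) ≤ π.length := by
  classical
  have hV' : (0 : ℝ) < 2 * Fintype.card V := by exact_mod_cast Nat.mul_pos two_pos hV
  have hq : (0 : ℝ) ≤ 1 - d / (2 * Fintype.card V) := by
    rw [sub_nonneg, div_le_one hV']
    exact_mod_cast hd
  have h := not_lt.1 fun h => hw (hπ.widthDerivable hS hV hd b ∅ h)
  have h1 : (1 : ℝ) ≤ π.length * Real.exp (-(d * b / (2 * Fintype.card V))) := by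
    refine h.trans (mul_le_mul ?_ ?_ (pow_nonneg hq _) (Nat.cast_nonneg _))
    · exact_mod_cast (Finset.card_filter_le _ _).trans (List.toFinset_card_le _)
    · have : -((d : ℝ) * b / (2 * Fintype.card V)) = b * (-(d / (2 * Fintype.card V))) := by ring
      rw [this, Real.exp_nat_mul]
      refine pow_le_pow_left₀ hq ?_ _
      have := Real.add_one_le_exp (-((d : ℝ) / (2 * Fintype.card V)))
      linarith
  rw [Real.exp_neg, ← div_eq_mul_inv, le_div_iff₀ (Real.exp_pos _)] at h1
  linarith

end Width

/-! ### Width lower bounds for sparse formulas -/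

/-- Small nonempty subformulas have many variables. -/
def Sparse {k : ℕ} {V : Type*} [DecidableEq V] (L : ℕ) (F : Finset (AppliedConstraint k V)) :
    Prop :=
  ∀ G ⊆ F, G.Nonempty → G.card ≤ L → (4 * k - 5) * G.card < 4 * (formulaVars G).card

/-- Comparing (k - 5/4)|G| < |Var(G)| with |Var(G)| ≤ (k - 3/2)|G| + |c|/2 leaves |G|/4 < |c|/2. -/
theorem Sparse.lt_two_mul_card {k : ℕ} {V : Type*} [DecidableEq V] {L : ℕ}
    {F G : Finset (AppliedConstraint k V)} (hF : Sparse L F) (hk : 3 ≤ k)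
    (himp : ∀ A ∈ F, ¬ HasImplicateOfLengthAtMost A.1 2) {c : Clause V} (hG : MinEntails G c)
    (hGF : G ⊆ F) (hne : G.Nonempty) (hL : G.card ≤ L) : G.card < 2 * c.card := by
  have h1 := hF G hGF hne hL
  have h2 := hG.two_mul_card_formulaVars_le fun A hA => himp A (hGF hA)
  obtain ⟨j, rfl⟩ := Nat.exists_eq_add_of_le hk
  have h3 : 4 * (3 + j) - 5 = 4 * j + 7 := by omega
  rw [h3] at h1
  nlinarith

/-- The invariant is that each derived clause is entailed by at most `s` constraints. A cut at most
doubles this number, and sparsity at scale `2 * s` pushes a minimal entailment of the short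
conclusion back below 2w ≤ s. The empty clause would then need a nonempty formula of size less than
0. -/
theorem Sparse.not_widthDerivable {k : ℕ} {V : Type*} [DecidableEq V] {s w : ℕ}
    {F : Finset (AppliedConstraint k V)} (hF : Sparse (2 * s) F) (hk : 3 ≤ k)
    (himp : ∀ A ∈ F, ¬ HasImplicateOfLengthAtMost A.1 2) (hs : 0 < s) (hw : 2 * w ≤ s)
    {S : Set (Clause V)} (hS : ∀ c ∈ S, ∃ A ∈ F, Entails {A} c) :
    ¬ WidthDerivable S ∅ w ∅ := by
  suffices h : ∀ c, WidthDerivable S ∅ w c → ∃ G ⊆ F, G.card ≤ s ∧ Entails G c by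
    intro hd
    obtain ⟨G, hGF, hGs, hG⟩ := h ∅ hd
    obtain ⟨H, hHG, hH⟩ := hG.exists_minEntails
    have := Finset.card_le_card hHG
    have := hF.lt_two_mul_card hk himp hH (hHG.trans hGF) hH.nonempty (by omega)
    simp at this
  intro c hc
  induction hc with
  | initial hc =>
    obtain ⟨A, hA, h⟩ := hS _ hc
    exact ⟨{A}, by simpa using hA, by simpa [Nat.one_le_iff_ne_zero] using hs.ne', h⟩
  | @tautology c hc =>
    obtain ⟨v, h1, h2⟩ := hc
    refine ⟨∅, by simp, by simp, fun a _ => ?_⟩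
    cases h : a v
    · exact ⟨_, h2, h⟩
    · exact ⟨_, h1, h⟩
  | weaken _ h ih =>
    obtain ⟨G, hGF, hGs, hG⟩ := ih
    exact ⟨G, hGF, hGs, hG.mono subset_rfl h⟩
  | @cut c x h _ _ ih1 ih2 =>
    obtain ⟨G₁, hF₁, hs₁, hG₁⟩ := ih1
    obtain ⟨G₂, hF₂, hs₂, hG₂⟩ := ih2
    have hu : Entails (G₁ ∪ G₂) c := fun a ha => by
      obtain ⟨l, hl, e⟩ := hG₁ a fun A hA => ha A (Finset.mem_union_left _ hA)
      obtain ⟨m, hm, e'⟩ := hG₂ a fun A hA => ha A (Finset.mem_union_right _ hA)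
      rcases Finset.mem_insert.1 hl with rfl | hl
      · rcases Finset.mem_insert.1 hm with rfl | hm
        · simp_all
        · exact ⟨m, hm, e'⟩
      · exact ⟨l, hl, e⟩
    obtain ⟨H, hHG, hH⟩ := hu.exists_minEntails
    have hHF := hHG.trans (Finset.union_subset hF₁ hF₂)
    refine ⟨H, hHF, ?_, hH.1⟩
    by_contra! hlt
    have h1 := (Finset.card_le_card hHG).trans (Finset.card_union_le _ _)
    have := hF.lt_two_mul_card hk himp hH hHF (Finset.card_pos.1 (by omega)) (by omega)
    rw [Finset.sdiff_empty] at h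
    omega

theorem exists_entails_of_mem_cnfClauses {k : ℕ} {V : Type*} {F : Finset (AppliedConstraint k V)}
    {cnf : Constraint k → Finset (Clause (Fin k))} (hcnf : IsCNFConversion cnf) {d : Clause V}
    (hd : d ∈ cnfClauses cnf (F : Set (AppliedConstraint k V))) : ∃ A ∈ F, Entails {A} d := by
  obtain ⟨A, hA, c, hc, rfl⟩ := hd
  refine ⟨A, hA, fun a ha => ?_⟩
  obtain ⟨l, hl, e⟩ := (hcnf A.1 _).1 (ha A (Finset.mem_singleton_self A)) c hc
  exact ⟨_, Finset.mem_map_of_mem _ hl, e⟩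

/-- The bound is 2k and not k because a conversion may contain tautological clauses. -/
theorem card_le_of_mem_cnfClauses {k : ℕ} {V : Type*} {F : Set (AppliedConstraint k V)}
    {cnf : Constraint k → Finset (Clause (Fin k))} {d : Clause V}
    (hd : d ∈ cnfClauses cnf F) : d.card ≤ 2 * k := by
  obtain ⟨A, hA, c, hc, rfl⟩ := hd
  rw [Finset.card_map]
  refine (Finset.card_le_univ c).trans ?_
  simp [mul_comm]

/-! ### Probabilities of events for random formulas -/

/-- The probability of a single random constraint. -/
noncomputable def constraintWeight {k : ℕ} (P : PMF (Constraint k)) {n : ℕ}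
    (A : AppliedConstraint k (Fin n)) : ℝ :=
  (P A.1).toReal / (Fintype.card (Fin k ↪ Fin n) : ℝ)

section Prob

variable {k : ℕ} {P : PMF (Constraint k)} {n m : ℕ}

theorem constraintWeight_nonneg (A : AppliedConstraint k (Fin n)) :
    0 ≤ constraintWeight P A :=
  div_nonneg ENNReal.toReal_nonneg (Nat.cast_nonneg _)

theorem formulaWeight_nonneg (Φ : Fin m → AppliedConstraint k (Fin n)) :
    0 ≤ formulaWeight P Φ :=
  Finset.prod_nonneg fun i _ => constraintWeight_nonneg (Φ i)

theorem prob_le_prob_of_support {E F : Set (Fin m → AppliedConstraint k (Fin n))}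
    (h : ∀ Φ ∈ E, (∀ i, (Φ i).1 ∈ P.support) → Φ ∈ F) : prob P n m E ≤ prob P n m F := by
  refine Finset.sum_le_sum fun Φ _ => ?_
  by_cases hΦ : Φ ∈ E
  · by_cases hs : ∀ i, (Φ i).1 ∈ P.support
    · rw [Set.indicator_of_mem hΦ, Set.indicator_of_mem (h Φ hΦ hs)]
    · push Not at hs
      obtain ⟨i, hi⟩ := hs
      rw [PMF.mem_support_iff, not_not] at hi
      have : formulaWeight P Φ = 0 := Finset.prod_eq_zero (Finset.mem_univ i) (by simp [hi])
      rw [Set.indicator_of_mem hΦ, this]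
      exact Set.indicator_nonneg (fun _ _ => formulaWeight_nonneg _) _
  · rw [Set.indicator_of_notMem hΦ]
    exact Set.indicator_nonneg (fun _ _ => formulaWeight_nonneg _) _

theorem prob_mono {E F : Set (Fin m → AppliedConstraint k (Fin n))} (h : E ⊆ F) :
    prob P n m E ≤ prob P n m F :=
  prob_le_prob_of_support fun _ hΦ _ => h hΦ

theorem prob_nonneg (E : Set (Fin m → AppliedConstraint k (Fin n))) : 0 ≤ prob P n m E :=
  Finset.sum_nonneg fun _ _ => Set.indicator_nonneg (fun _ _ => formulaWeight_nonneg _) _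

theorem prob_biUnion_le {ι : Type*} (s : Finset ι)
    (E : ι → Set (Fin m → AppliedConstraint k (Fin n))) :
    prob P n m (⋃ i ∈ s, E i) ≤ ∑ i ∈ s, prob P n m (E i) := by
  unfold prob
  rw [Finset.sum_comm]
  refine Finset.sum_le_sum fun Φ _ => ?_
  have h0 : ∀ i ∈ s, 0 ≤ (E i).indicator (formulaWeight P) Φ := fun i _ =>
    Set.indicator_nonneg (fun _ _ => formulaWeight_nonneg _) _
  by_cases h : Φ ∈ ⋃ i ∈ s, E i
  · rw [Set.indicator_of_mem h]
    simp only [Set.mem_iUnion] at h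
    obtain ⟨i, hi, h⟩ := h
    refine le_trans ?_ (Finset.single_le_sum h0 hi)
    rw [Set.indicator_of_mem h]
  · rw [Set.indicator_of_notMem h]
    exact Finset.sum_nonneg h0

theorem prob_union_le (E F : Set (Fin m → AppliedConstraint k (Fin n))) :
    prob P n m (E ∪ F) ≤ prob P n m E + prob P n m F := by
  have h := prob_biUnion_le (P := P) Finset.univ fun b : Bool => bif b then E else F
  refine (prob_mono fun Φ hΦ => ?_).trans (h.trans (by simp))
  simp only [Finset.mem_univ, Set.iUnion_true, Set.mem_iUnion, Bool.exists_bool, cond_true,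
    cond_false]
  exact hΦ.symm

theorem sum_toReal_eq_one : ∑ C, (P C).toReal = 1 := by
  rw [← ENNReal.toReal_sum fun C _ => P.apply_ne_top C, ← tsum_fintype (L := .unconditional _),
    P.tsum_coe]
  simp

theorem card_embedding_pos (hkn : k ≤ n) : (0 : ℝ) < Fintype.card (Fin k ↪ Fin n) := by
  rw [Fintype.card_embedding_eq]
  simpa [Nat.descFactorial_pos] using hkn

theorem sum_constraintWeight (hkn : k ≤ n) :
    ∑ A : AppliedConstraint k (Fin n), constraintWeight P A = 1 := by
  unfold constraintWeight
  rw [Fintype.sum_prod_type]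
  have := (card_embedding_pos hkn).ne'
  simp only [Finset.sum_const, Finset.card_univ, nsmul_eq_mul, mul_div_cancel₀ _ this]
  exact sum_toReal_eq_one

-- Independence of the constraints. The condition k ≤ n is what makes the weights of a single
-- constraint sum to 1.
open Classical in
theorem prob_forall_mem (hkn : k ≤ n) (I : Finset (Fin m))
    (T : Finset (AppliedConstraint k (Fin n))) :
    prob P n m {Φ | ∀ i ∈ I, Φ i ∈ T} = (∑ A ∈ T, constraintWeight P A) ^ I.card := by
  have h1 : prob P n m {Φ | ∀ i ∈ I, Φ i ∈ T} =
      ∑ Φ ∈ Fintype.piFinset fun i => if i ∈ I then T else Finset.univ,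
        ∏ i, constraintWeight P (Φ i) := by
    unfold prob
    simp only [Set.indicator_apply]
    rw [← Finset.sum_filter]
    refine Finset.sum_congr ?_ fun _ _ => rfl
    ext Φ
    simp only [Finset.mem_filter, Finset.mem_univ, true_and, Set.mem_ofPred_eq,
      Fintype.mem_piFinset]
    refine forall_congr' fun i => ?_
    by_cases hi : i ∈ I <;> simp [hi]
  rw [h1, ← Finset.prod_univ_sum, ← Finset.prod_const, ← Finset.prod_subset I.subset_univ]
  · exact Finset.prod_congr rfl fun i hi => by rw [if_pos hi]
  · intro i _ hi
    rw [if_neg hi, sum_constraintWeight hkn]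

theorem prob_univ (hkn : k ≤ n) : prob P n m Set.univ = 1 := by
  have := prob_forall_mem (P := P) hkn (∅ : Finset (Fin m)) ∅
  simpa using this

theorem prob_le_one (hkn : k ≤ n) (E : Set (Fin m → AppliedConstraint k (Fin n))) :
    prob P n m E ≤ 1 :=
  (prob_mono (Set.subset_univ E)).trans (prob_univ hkn).le

theorem one_sub_prob_le {E F : Set (Fin m → AppliedConstraint k (Fin n))} (hkn : k ≤ n)
    (h : ∀ Φ ∉ E, (∀ i, (Φ i).1 ∈ P.support) → Φ ∈ F) : 1 - prob P n m E ≤ prob P n m F := by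
  have h1 : prob P n m Set.univ ≤ prob P n m (E ∪ F) :=
    prob_le_prob_of_support fun Φ _ hs => by
      by_cases hE : Φ ∈ E
      · exact Or.inl hE
      · exact Or.inr (h Φ hE hs)
  have := prob_union_le (P := P) E F
  rw [prob_univ hkn] at h1
  linarith

open Classical in
theorem card_filter_forall_mem (S : Finset (Fin n)) :
    (Finset.univ.filter fun e : Fin k ↪ Fin n => ∀ i, e i ∈ S).card = S.card.descFactorial k := by
  have h := Fintype.card_embedding_eq (α := Fin k) (β := S)
  rw [Fintype.card_fin, Fintype.card_coe] at h
  rw [← h, ← Fintype.card_subtype]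
  exact Fintype.card_congr
    { toFun := fun e => e.1.codRestrict S e.2
      invFun := fun f => ⟨f.trans (Function.Embedding.subtype _), fun i => (f i).2⟩
      left_inv := fun e => by ext; rfl
      right_inv := fun f => by ext; rfl }

theorem descFactorial_div_le {s : ℕ} (hs : s ≤ n) (hkn : k ≤ n) :
    (s.descFactorial k : ℝ) / n.descFactorial k ≤ ((s : ℝ) / n) ^ k := by
  induction k with
  | zero => simp
  | succ k ih =>
    have hn : (0 : ℝ) < (n - k : ℕ) := by exact_mod_cast (by omega : 0 < n - k)
    have hn' : (0 : ℝ) < n := by exact_mod_cast (by omega : 0 < n)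
    rw [Nat.descFactorial_succ, Nat.descFactorial_succ, pow_succ', Nat.cast_mul, Nat.cast_mul,
      mul_div_mul_comm]
    refine mul_le_mul ?_ (ih (by omega)) (by positivity) (by positivity)
    rw [div_le_div_iff₀ hn hn']
    norm_cast
    rcases le_total s k with h | h
    · simp [Nat.sub_eq_zero_of_le h]
    · obtain ⟨u, rfl⟩ := Nat.exists_eq_add_of_le h
      obtain ⟨v, rfl⟩ := Nat.exists_eq_add_of_le hs
      rw [Nat.add_sub_cancel_left, add_assoc, Nat.add_sub_cancel_left]
      nlinarith

open Classical in
/-- The probability that the variables of a random constraint belong to a given set. -/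
theorem sum_constraintWeight_le (hkn : k ≤ n) (S : Finset (Fin n)) :
    ∑ A ∈ Finset.univ.filter (fun A : AppliedConstraint k (Fin n) => ∀ i, A.2 i ∈ S),
      constraintWeight P A ≤ ((S.card : ℝ) / n) ^ k := by
  have h1 : ∑ A ∈ Finset.univ.filter (fun A : AppliedConstraint k (Fin n) => ∀ i, A.2 i ∈ S),
      constraintWeight P A = (S.card.descFactorial k : ℝ) / n.descFactorial k := by
    rw [Finset.sum_filter, Fintype.sum_prod_type]
    unfold constraintWeight
    simp only [← Finset.sum_filter, Finset.sum_const, card_filter_forall_mem, nsmul_eq_mul,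
      Fintype.card_embedding_eq, Fintype.card_fin]
    rw [← Finset.mul_sum, ← Finset.sum_div, sum_toReal_eq_one, mul_one_div]
  rw [h1]
  exact descFactorial_div_le ((Finset.card_le_univ S).trans (by simp)) hkn

/-! ### Sparsity of random formulas -/

theorem choose_mul_pow_le {N : ℕ} {c : ℝ} {n : ℕ} (hN : (N : ℝ) ≤ c * n) {m : ℕ} (hm : 0 < m) :
    (N.choose m : ℝ) ≤ (Real.exp 1 * c * n / m) ^ m := by
  have hm' : (0 : ℝ) < m := by exact_mod_cast hm
  have h1 : (m : ℝ) ^ m / m.factorial ≤ Real.exp m :=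
    Real.pow_div_factorial_le_exp _ hm'.le m
  calc (N.choose m : ℝ) ≤ (N : ℝ) ^ m / m.factorial := Nat.choose_le_pow_div m N
    _ ≤ (c * n) ^ m / m.factorial := by gcongr
    _ = ((c * n) ^ m / m ^ m) * ((m : ℝ) ^ m / m.factorial) := by
      field_simp
    _ ≤ ((c * n) ^ m / m ^ m) * Real.exp m := by
      refine mul_le_mul_of_nonneg_left h1 (div_nonneg (pow_nonneg ?_ _) (by positivity))
      exact (Nat.cast_nonneg N).trans hN
    _ = (Real.exp 1 * c * n / m) ^ m := by
      rw [← mul_one (m : ℝ), Real.exp_nat_mul, mul_one, div_pow, mul_assoc, mul_pow, mul_pow]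
      ring

/-- After the binomial coefficient absorbs `r` of the `k * m` factors r/n, at least 5m/4 remain. One
factor km/n per constraint will cancel the choice of the constraints; the surplus quarter power `q`
makes the union bound converge. -/
theorem choose_mul_div_pow_le {n m k r : ℕ} {q : ℝ} (hn : 0 < n) (hq : 0 ≤ q) (hq1 : q ≤ 1)
    (hqn : q ^ 4 = (k * m : ℝ) / n) (hr : 4 * r + 5 * m ≤ 4 * (k * m)) :
    (n.choose r : ℝ) * (((r : ℝ) / n) ^ k) ^ m ≤
      Real.exp (k * m : ℕ) * ((k * m : ℝ) / n * q) ^ m := by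
  have hn' : (0 : ℝ) < n := by exact_mod_cast hn
  have hrk : (r : ℝ) ≤ k * m := by exact_mod_cast (by omega : r ≤ k * m)
  have h1 : (r : ℝ) ^ r / r.factorial ≤ Real.exp r :=
    Real.pow_div_factorial_le_exp _ (Nat.cast_nonneg _) r
  have h2 : ((r : ℝ) / n) ^ (k * m - r) ≤ ((k * m : ℝ) / n * q) ^ m := by
    calc ((r : ℝ) / n) ^ (k * m - r) ≤ ((k * m : ℝ) / n) ^ (k * m - r) := by gcongr
      _ = q ^ (4 * (k * m - r)) := by rw [← hqn, pow_mul]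
      _ ≤ q ^ (5 * m) := pow_le_pow_of_le_one hq hq1 (by omega)
      _ = ((k * m : ℝ) / n * q) ^ m := by
        rw [← hqn, ← pow_succ, ← pow_mul]
  calc (n.choose r : ℝ) * (((r : ℝ) / n) ^ k) ^ m
      ≤ ((n : ℝ) ^ r / r.factorial) * (((r : ℝ) / n) ^ k) ^ m := by
        gcongr
        exact Nat.choose_le_pow_div r n
    _ = ((r : ℝ) ^ r / r.factorial) * ((r : ℝ) / n) ^ (k * m - r) := by
        rw [← pow_mul]
        nth_rewrite 1 [← Nat.sub_add_cancel (show r ≤ k * m by omega)]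
        rw [pow_add, div_pow (r : ℝ) n r]
        field_simp
    _ ≤ Real.exp r * ((k * m : ℝ) / n * q) ^ m := by gcongr
    _ ≤ Real.exp (k * m : ℕ) * ((k * m : ℝ) / n * q) ^ m := by
        gcongr
        exact_mod_cast hrk

open Classical in
/-- The union bound for the subformulas with `m` constraints that have few variables. -/
theorem prob_exists_few_vars_le {M : ℕ} {c q : ℝ} (hc : 0 < c) {J : Finset (Fin M)}
    (hJ : (J.card : ℝ) ≤ c * n) (hm : 0 < m) (hkm : k * m ≤ n) (hk : 3 ≤ k)
    (hq : 0 ≤ q) (hqn : q ^ 4 = (k * m : ℝ) / n) :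
    prob P n M {Φ | ∃ I ⊆ J, I.card = m ∧ ∃ S : Finset (Fin n), 4 * S.card ≤ (4 * k - 5) * m ∧
      ∀ i ∈ I, ∀ j, (Φ i).2 j ∈ S} ≤ (Real.exp (k + 1) * c * k * q) ^ m := by
  have hkn : k ≤ n := (Nat.le_mul_of_pos_right k hm).trans hkm
  have hn : 0 < n := by omega
  have hn' : (0 : ℝ) < n := by exact_mod_cast hn
  have hm' : (0 : ℝ) < m := by exact_mod_cast hm
  have hq1 : q ≤ 1 := by
    refine (pow_le_one_iff_of_nonneg hq four_ne_zero).1 ?_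
    rw [hqn, div_le_one hn']
    exact_mod_cast hkm
  set r := (4 * k - 5) * m / 4 with hr
  have hkm5 : (4 * k - 5) * m + 5 * m = 4 * (k * m) := by
    rw [← add_mul, Nat.sub_add_cancel (by omega)]
    ring
  have hsub : {Φ : Fin M → AppliedConstraint k (Fin n) | ∃ I ⊆ J, I.card = m ∧
      ∃ S : Finset (Fin n), 4 * S.card ≤ (4 * k - 5) * m ∧ ∀ i ∈ I, ∀ j, (Φ i).2 j ∈ S} ⊆
      ⋃ x ∈ J.powersetCard m ×ˢ (Finset.univ : Finset (Fin n)).powersetCard r,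
        {Φ | ∀ i ∈ x.1, Φ i ∈ Finset.univ.filter
          fun A : AppliedConstraint k (Fin n) => ∀ j, A.2 j ∈ x.2} := by
    rintro Φ ⟨I, hI, hIm, S, hS, h⟩
    -- Enlarging `S` to size exactly `r` leaves a single binomial coefficient in the union bound.
    obtain ⟨S', hSS', hS'⟩ := Finset.exists_superset_card_eq (s := S) (n := r) (by omega)
      (by rw [Fintype.card_fin]; omega)
    simp only [Set.mem_iUnion]
    refine ⟨(I, S'), by simp [hI, hIm, hS'], ?_⟩
    simp only [Set.mem_ofPred_eq, Finset.mem_filter, Finset.mem_univ, true_and]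
    exact fun i hi j => hSS' (h i hi j)
  refine (prob_mono hsub).trans ((prob_biUnion_le _ _).trans ?_)
  have hterm : ∀ x ∈ J.powersetCard m ×ˢ (Finset.univ : Finset (Fin n)).powersetCard r,
      prob P n M {Φ | ∀ i ∈ x.1, Φ i ∈ Finset.univ.filter
        fun A : AppliedConstraint k (Fin n) => ∀ j, A.2 j ∈ x.2} ≤
        (((r : ℝ) / n) ^ k) ^ m := by
    rintro ⟨I, S⟩ hx
    simp only [Finset.mem_product, Finset.mem_powersetCard] at hx
    rw [prob_forall_mem hkn, hx.1.2, ← hx.2.2]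
    refine pow_le_pow_left₀ (Finset.sum_nonneg fun _ _ => constraintWeight_nonneg _) ?_ _
    exact sum_constraintWeight_le hkn S
  refine (Finset.sum_le_card_nsmul _ _ _ hterm).trans ?_
  rw [Finset.card_product, Finset.card_powersetCard, Finset.card_powersetCard, Finset.card_univ,
    Fintype.card_fin, nsmul_eq_mul, Nat.cast_mul, mul_assoc]
  calc (J.card.choose m : ℝ) * ((n.choose r : ℝ) * (((r : ℝ) / n) ^ k) ^ m)
      ≤ (Real.exp 1 * c * n / m) ^ m * (Real.exp (k * m : ℕ) * ((k * m : ℝ) / n * q) ^ m) := by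
        refine mul_le_mul (choose_mul_pow_le hJ hm)
          (choose_mul_div_pow_le hn hq hq1 hqn (by omega)) (by positivity) (by positivity)
    _ = (Real.exp (k + 1) * c * k * q) ^ m := by
        rw [Real.exp_add, mul_comm k m, Nat.cast_mul, Real.exp_nat_mul, ← mul_pow, ← mul_pow]
        congr 1
        field_simp

/-- Repeated constraints collapse in the image, so each subformula is represented by a set of
indices on which `Φ` is injective. -/
theorem Sparse.of_forall_index {M L : ℕ} {Φ : Fin M → AppliedConstraint k (Fin n)}
    {J : Finset (Fin M)} (h : ∀ m ∈ Finset.Icc 1 L, ¬ ∃ I ⊆ J, I.card = m ∧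
      ∃ S : Finset (Fin n), 4 * S.card ≤ (4 * k - 5) * m ∧ ∀ i ∈ I, ∀ j, (Φ i).2 j ∈ S) :
    Sparse L (J.image Φ) := by
  intro G hG hne hGL
  by_contra! hlt
  obtain ⟨I, hIJ, hinj, rfl⟩ := Finset.exists_subset_injOn_image_eq_of_surjOn (f := Φ) J G
    (by
      intro A hA
      simpa using hG hA)
  rw [Finset.card_image_of_injOn hinj] at hlt hGL
  refine h I.card (Finset.mem_Icc.2 ⟨?_, hGL⟩) ⟨I, by exact_mod_cast hIJ, rfl, _, hlt,
    fun i hi j => mem_formulaVars.2 ⟨_, Finset.mem_image_of_mem _ hi, j, rfl⟩⟩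
  exact Finset.card_pos.2 (Finset.image_nonempty.1 hne)

end Prob

/-- Dominated convergence: each term tends to 0, and the cutoff m ≤ σn bounds the m-th term by
2^(-m). -/
theorem tendsto_tsum_pow_rpow {k : ℕ} {K σ : ℝ} (hK : 0 ≤ K)
    (hσ : K * (k * σ) ^ (1 / 4 : ℝ) ≤ 1 / 2) (hσ0 : 0 ≤ σ) :
    Tendsto (fun n : ℕ => ∑' m : ℕ, if 1 ≤ m ∧ (m : ℝ) ≤ σ * n then
      (K * ((k * m : ℝ) / n) ^ (1 / 4 : ℝ)) ^ m else 0) atTop (𝓝 0) ∧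
    ∀ n : ℕ, Summable fun m : ℕ => if 1 ≤ m ∧ (m : ℝ) ≤ σ * n then
      (K * ((k * m : ℝ) / n) ^ (1 / 4 : ℝ)) ^ m else 0 := by
  have hb : ∀ n m : ℕ, ‖(if 1 ≤ m ∧ (m : ℝ) ≤ σ * n then
      (K * ((k * m : ℝ) / n) ^ (1 / 4 : ℝ)) ^ m else 0 : ℝ)‖ ≤ (1 / 2) ^ m := by
    intro n m
    split_ifs with h
    · rw [Real.norm_of_nonneg (by positivity)]
      refine pow_le_pow_left₀ (by positivity) (le_trans ?_ hσ) _
      gcongr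
      rw [mul_div_assoc]
      gcongr
      rcases (Nat.cast_nonneg n : (0 : ℝ) ≤ n).eq_or_lt with hn | hn
      · simpa [← hn] using hσ0
      · rw [div_le_iff₀ hn]
        exact h.2
    · simp
  have hs : Summable fun m : ℕ => ((1 : ℝ) / 2) ^ m :=
    summable_geometric_of_lt_one (by norm_num) (by norm_num)
  refine ⟨?_, fun n => hs.of_norm_bounded (hb n)⟩
  rw [show 𝓝 (0 : ℝ) = 𝓝 (∑' _ : ℕ, (0 : ℝ)) by rw [tsum_zero]]
  refine tendsto_tsum_of_dominated_convergence hs (fun m => ?_) (.of_forall hb)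
  rcases Nat.eq_zero_or_pos m with rfl | hm
  · simp
  · have h1 : Tendsto (fun n : ℕ => (K * ((k * m : ℝ) / n) ^ (1 / 4 : ℝ)) ^ m) atTop (𝓝 0) := by
      have h2 : Tendsto (fun n : ℕ => (k * m : ℝ) / n) atTop (𝓝 0) :=
        tendsto_const_div_atTop_nhds_zero_nat _
      have h3 := ((h2.rpow_const (p := 1 / 4) (Or.inr (by norm_num))).const_mul K).pow m
      simpa [hm.ne'] using h3
    refine squeeze_zero (fun n => ?_) (fun n => ?_) h1
    · split_ifs <;> positivity
    · split_ifs
      · exact le_rfl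
      · exact pow_nonneg (mul_nonneg hK (Real.rpow_nonneg (by positivity) _)) m

/-- Random formulas of bounded density are sparse with high probability. -/
theorem exists_prob_not_sparse_le {k : ℕ} (P : PMF (Constraint k)) (hk : 3 ≤ k) {c : ℝ}
    (hc : 0 < c) : ∃ σ : ℝ, 0 < σ ∧ σ ≤ 1 ∧ ∃ f : ℕ → ℝ, Tendsto f atTop (𝓝 0) ∧
      ∀ (n M : ℕ) (J : Finset (Fin M)), (J.card : ℝ) ≤ c * n →
        prob P n M {Φ | ¬ Sparse ⌊σ * n⌋₊ (J.image Φ)} ≤ f n := by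
  set K : ℝ := Real.exp (k + 1) * c * k with hKdef
  have hk' : (3 : ℝ) ≤ k := by exact_mod_cast hk
  have hK : 0 < K := by positivity
  -- Then K(kσ)^(1/4) = K/(2K + 1) ≤ 1/2, and kσ ≤ 1 gives km ≤ n for all m ≤ σn.
  set σ : ℝ := ((2 * K + 1)⁻¹) ^ 4 / k with hσdef
  have hσ : 0 < σ := by positivity
  have hkσ : k * σ = ((2 * K + 1)⁻¹) ^ 4 := by
    rw [hσdef]
    field_simp
  have hkσ1 : k * σ ≤ 1 := by
    rw [hkσ]
    exact pow_le_one₀ (by positivity) (inv_le_one_of_one_le₀ (by linarith))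
  have hroot : K * (k * σ) ^ (1 / 4 : ℝ) ≤ 1 / 2 := by
    have h4 := Real.pow_rpow_inv_natCast (x := (2 * K + 1)⁻¹) (n := 4) (by positivity) (by norm_num)
    rw [Nat.cast_ofNat] at h4
    rw [hkσ, one_div (4 : ℝ), h4, ← div_eq_mul_inv, div_le_iff₀ (by positivity)]
    linarith
  obtain ⟨hf, hsum⟩ := tendsto_tsum_pow_rpow hK.le hroot hσ.le
  refine ⟨σ, hσ, by nlinarith, _, hf, fun n M J hJ => ?_⟩
  have hsub : {Φ : Fin M → AppliedConstraint k (Fin n) | ¬ Sparse ⌊σ * n⌋₊ (J.image Φ)} ⊆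
      ⋃ m ∈ Finset.Icc 1 ⌊σ * n⌋₊, {Φ | ∃ I ⊆ J, I.card = m ∧
        ∃ S : Finset (Fin n), 4 * S.card ≤ (4 * k - 5) * m ∧ ∀ i ∈ I, ∀ j, (Φ i).2 j ∈ S} := by
    intro Φ hΦ
    by_contra h
    simp only [Set.mem_iUnion, not_exists] at h
    exact hΦ (.of_forall_index fun m hm => h m hm)
  refine (prob_mono hsub).trans ((prob_biUnion_le _ _).trans ?_)
  refine le_trans (Finset.sum_le_sum fun m hm => ?_) ((hsum n).sum_le_tsum
    (Finset.Icc 1 ⌊σ * n⌋₊) fun m _ => by split_ifs <;> positivity)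
  rw [Finset.mem_Icc] at hm
  have hmn : (m : ℝ) ≤ σ * n := (Nat.le_floor_iff (by positivity)).1 hm.2
  rw [if_pos ⟨hm.1, hmn⟩]
  refine prob_exists_few_vars_le hc hJ hm.1 ?_ hk (by positivity) ?_
  · have : (k : ℝ) * m ≤ n := by
      calc (k : ℝ) * m ≤ k * (σ * n) := by gcongr
        _ = (k * σ) * n := by ring
        _ ≤ 1 * n := by gcongr
        _ = n := one_mul _
    exact_mod_cast this
  · have h4 := Real.rpow_inv_natCast_pow (x := (k * m : ℝ) / n) (n := 4) (by positivity)
      (by norm_num)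
    rwa [Nat.cast_ofNat, ← one_div] at h4

/-! ### Unsatisfiability of dense random formulas -/

section Threshold

variable {k : ℕ} {P : PMF (Constraint k)} {n : ℕ}

/-- Otherwise the constant assignment `b` would satisfy random formulas of every density, even above
the threshold. -/
theorem HasSharpThreshold.exists_const_notMem (h : HasSharpThreshold P) (b : Bool) :
    ∃ C ∈ P.support, (fun _ => b) ∉ C.1 := by
  by_contra! hb
  obtain ⟨c, -, hc⟩ := h
  have h0 := (hc 1 one_pos fun n => ⌈(c n + 1) * n⌉₊ + 1).2 (.of_forall fun n => by
    push_cast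
    exact (Nat.le_ceil _).trans_lt (lt_add_one _))
  have h1 : Tendsto (fun n => probSat P n (⌈(c n + 1) * n⌉₊ + 1)) atTop (𝓝 1) := by
    refine tendsto_const_nhds.congr' ((eventually_ge_atTop k).mono fun n hn => ?_)
    refine le_antisymm ?_ (prob_le_one hn _)
    refine (prob_univ (P := P) (m := ⌈(c n + 1) * n⌉₊ + 1) hn).ge.trans ?_
    refine prob_le_prob_of_support (F := {Φ | Satisfiable (Set.range Φ)}) fun Φ _ hΦ =>
      ⟨fun _ => b, ?_⟩
    rintro _ ⟨i, rfl⟩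
    exact hb _ (hΦ i)
  exact zero_ne_one (tendsto_nhds_unique h0 h1)

theorem three_le_of_exists_notMem {C : Constraint k} {b : Fin k → Bool} (hb : b ∉ C.1)
    (hC : ¬ HasImplicateOfLengthAtMost C 2) : 3 ≤ k := by
  by_contra! hk
  obtain ⟨a, ha, hab⟩ := exists_extension_of_not_hasImplicate hC Finset.univ
    (by simpa using Nat.le_of_lt_succ hk) b
  exact hb (funext (fun i => hab i (Finset.mem_univ i)) ▸ ha)

theorem quarter_pow_le_descFactorial_div {s : ℕ} (hkn : k ≤ n) (hn : 4 * k ≤ n)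
    (hs : n ≤ 2 * s) : (1 / 4 : ℝ) ^ k ≤ (s.descFactorial k : ℝ) / n.descFactorial k := by
  have h0 : (0 : ℝ) < n.descFactorial k := by
    exact_mod_cast Nat.descFactorial_pos.2 hkn
  have h1 : ((s + 1 - k : ℕ) : ℝ) ^ k ≤ s.descFactorial k := by
    exact_mod_cast Nat.pow_sub_le_descFactorial s k
  have h2 : (n.descFactorial k : ℝ) ≤ (n : ℝ) ^ k := by
    exact_mod_cast Nat.descFactorial_le_pow n k
  have h3 : (n : ℝ) ≤ 4 * (s + 1 - k : ℕ) := by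
    exact_mod_cast (by omega : n ≤ 4 * (s + 1 - k))
  rw [le_div_iff₀ h0]
  calc (1 / 4 : ℝ) ^ k * n.descFactorial k ≤ (1 / 4) ^ k * (n : ℝ) ^ k := by gcongr
    _ = (1 / 4 * n) ^ k := (mul_pow _ _ _).symm
    _ ≤ ((s + 1 - k : ℕ) : ℝ) ^ k := by
      gcongr
      linarith
    _ ≤ s.descFactorial k := h1

-- With probability at least P(C)·4^(-k) a random constraint has template `C` and all its variables
-- in the half where `a` equals `b`; it is then violated.
open Classical in
theorem sum_constraintWeight_holds_le (hkn : k ≤ n) (hn : 4 * k ≤ n) (a : Fin n → Bool)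
    {C : Constraint k} {b : Bool} (hC : (fun _ => b) ∉ C.1)
    (hb : n ≤ 2 * (Finset.univ.filter fun v => a v = b).card) :
    ∑ A ∈ Finset.univ.filter (fun A : AppliedConstraint k (Fin n) => A.Holds a),
      constraintWeight P A ≤ 1 - (P C).toReal * (1 / 4) ^ k := by
  set S := Finset.univ.filter fun v => a v = b with hS
  set E := Finset.univ.filter fun e : Fin k ↪ Fin n => ∀ i, e i ∈ S with hE
  have h1 : ∑ A ∈ E.image fun e => (C, e), constraintWeight P A =
      (P C).toReal * ((S.card.descFactorial k : ℝ) / n.descFactorial k) := by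
    rw [Finset.sum_image (by simp)]
    unfold constraintWeight
    simp only [Finset.sum_const, hE, card_filter_forall_mem, nsmul_eq_mul,
      Fintype.card_embedding_eq, Fintype.card_fin]
    ring
  have h2 : Disjoint (Finset.univ.filter fun A : AppliedConstraint k (Fin n) => A.Holds a)
      (E.image fun e => (C, e)) := by
    rw [Finset.disjoint_left]
    intro A hA hA'
    obtain ⟨e, he, rfl⟩ := Finset.mem_image.1 hA'
    refine hC ?_
    have h3 : (fun i => a (e i)) = fun _ => b := funext fun i => by
      simpa [hS] using (Finset.mem_filter.1 he).2 i
    rw [← h3]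
    exact (Finset.mem_filter.1 hA).2
  have h3 : ∑ A ∈ Finset.univ.filter (fun A : AppliedConstraint k (Fin n) => A.Holds a),
      constraintWeight P A + ∑ A ∈ E.image fun e => (C, e), constraintWeight P A ≤ 1 := by
    rw [← Finset.sum_union h2, ← sum_constraintWeight (P := P) hkn]
    exact Finset.sum_le_sum_of_subset_of_nonneg (Finset.subset_univ _)
      fun _ _ _ => constraintWeight_nonneg _
  rw [h1] at h3
  have h4 := mul_le_mul_of_nonneg_left (quarter_pow_le_descFactorial_div hkn hn hb)
    (ENNReal.toReal_nonneg (a := P C))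
  linarith

open Classical in
theorem exists_sum_constraintWeight_holds_le
    (h : ∀ b : Bool, ∃ C ∈ P.support, (fun _ => b) ∉ C.1) :
    ∃ ρ : ℝ, ρ < 1 ∧ ∀ n : ℕ, 4 * k ≤ n → ∀ a : Fin n → Bool,
      ∑ A ∈ Finset.univ.filter (fun A : AppliedConstraint k (Fin n) => A.Holds a),
        constraintWeight P A ≤ ρ := by
  choose C hC hCb using h
  have hpos : ∀ b, 0 < (P (C b)).toReal := fun b =>
    ENNReal.toReal_pos ((P.mem_support_iff _).1 (hC b)) (P.apply_ne_top _)
  refine ⟨1 - min (P (C true)).toReal (P (C false)).toReal * (1 / 4) ^ k, ?_,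
    fun n hn a => ?_⟩
  · have := mul_pos (lt_min (hpos true) (hpos false)) (pow_pos (by norm_num : (0 : ℝ) < 1 / 4) k)
    linarith
  · have hcard : (Finset.univ.filter fun v => a v = true).card +
        (Finset.univ.filter fun v => a v = false).card = n := by
      have := Finset.card_filter_add_card_filter_not (s := (Finset.univ : Finset (Fin n)))
        (fun v => a v = true)
      simpa using this
    have hb : ∃ b, n ≤ 2 * (Finset.univ.filter fun v => a v = b).card := by
      by_contra! hb
      have h1 := hb true
      have h2 := hb false
      omega
    obtain ⟨b, hb⟩ := hb
    refine (sum_constraintWeight_holds_le (by omega) hn a (hCb b) hb).trans ?_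
    gcongr
    cases b
    · exact min_le_right _ _
    · exact min_le_left _ _

/-- Random formulas of large density are unsatisfiable with high probability. -/
theorem exists_prob_satisfiable_le (h : ∀ b : Bool, ∃ C ∈ P.support, (fun _ => b) ∉ C.1) :
    ∃ D : ℕ, 0 < D ∧ ∀ n : ℕ, 4 * k ≤ n → ∀ (M : ℕ) (J : Finset (Fin M)), D * n ≤ J.card →
      prob P n M {Φ | Satisfiable (J.image Φ : Set (AppliedConstraint k (Fin n)))} ≤
        (1 / 2) ^ n := by
  classical
  obtain ⟨ρ', hρ', hsum'⟩ := exists_sum_constraintWeight_holds_le h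
  set ρ := max ρ' 0 with hρ
  have hρ1 : ρ < 1 := max_lt hρ' one_pos
  have hρ0 : 0 ≤ ρ := le_max_right _ _
  -- With ρ^D < 1/4, the union bound over 2^n assignments leaves 2^(-n).
  obtain ⟨D, hD⟩ := exists_pow_lt_of_lt_one (show (0 : ℝ) < 1 / 4 by norm_num) hρ1
  have hD0 : D ≠ 0 := by
    rintro rfl
    norm_num at hD
  refine ⟨D, Nat.pos_of_ne_zero hD0, fun n hn M J hJ => ?_⟩
  have hsub : {Φ : Fin M → AppliedConstraint k (Fin n) |
      Satisfiable (J.image Φ : Set (AppliedConstraint k (Fin n)))} ⊆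
      ⋃ a ∈ (Finset.univ : Finset (Fin n → Bool)), {Φ | ∀ i ∈ J, Φ i ∈ Finset.univ.filter
        fun A : AppliedConstraint k (Fin n) => A.Holds a} := by
    rintro Φ ⟨a, ha⟩
    simp only [Set.mem_iUnion]
    refine ⟨a, Finset.mem_univ a, fun i hi => ?_⟩
    simpa using ha _ (Finset.mem_coe.2 (Finset.mem_image_of_mem Φ hi))
  refine (prob_mono hsub).trans ((prob_biUnion_le _ _).trans ?_)
  have hterm : ∀ a ∈ (Finset.univ : Finset (Fin n → Bool)), prob P n M {Φ | ∀ i ∈ J,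
      Φ i ∈ Finset.univ.filter fun A : AppliedConstraint k (Fin n) => A.Holds a} ≤
      (1 / 4) ^ n := by
    intro a _
    rw [prob_forall_mem (by omega)]
    calc _ ≤ ρ ^ J.card := pow_le_pow_left₀
          (Finset.sum_nonneg fun _ _ => constraintWeight_nonneg _)
          ((hsum' n hn a).trans (le_max_left _ _)) _
      _ ≤ ρ ^ (D * n) := pow_le_pow_of_le_one hρ0 hρ1.le hJ
      _ = (ρ ^ D) ^ n := pow_mul _ _ _
      _ ≤ (1 / 4) ^ n := pow_le_pow_left₀ (pow_nonneg hρ0 _) hD.le _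
  refine (Finset.sum_le_card_nsmul _ _ _ hterm).trans_eq ?_
  simp only [Finset.card_univ, Fintype.card_fun, Fintype.card_bool, Fintype.card_fin,
    nsmul_eq_mul, Nat.cast_pow, Nat.cast_ofNat]
  rw [← mul_pow]
  norm_num

end Threshold

/-! ### Minimally unsatisfiable subformulas and the spine -/

theorem exists_minEntails_empty_subset {k : ℕ} {V : Type*} [DecidableEq V]
    {F : Finset (AppliedConstraint k V)} (h : ¬ Satisfiable (F : Set (AppliedConstraint k V))) :
    ∃ G ⊆ F, MinEntails G ∅ :=
  (entails_empty_iff.2 h).exists_minEntails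

/-- Deleting any constraint `A` leaves a satisfiable formula that `A` itself makes unsatisfiable
again, so all variables of `A` are witnessed. -/
theorem MinEntails.formulaVars_subset_spine {k : ℕ} {P : PMF (Constraint k)} {V : Type*}
    [DecidableEq V] {G : Finset (AppliedConstraint k V)} (hG : MinEntails G ∅)
    {F : Set (AppliedConstraint k V)} (hGF : (G : Set (AppliedConstraint k V)) ⊆ F)
    (hP : ∀ A ∈ G, A.1 ∈ P.support) : (formulaVars G : Set V) ⊆ spine P F := by
  intro v hv
  obtain ⟨A, hA, i, rfl⟩ := mem_formulaVars.1 (Finset.mem_coe.1 hv)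
  refine ⟨(G.erase A : Finset _), fun B hB => hGF (Finset.erase_subset _ _ hB), ?_, A, hP A hA,
    ⟨i, rfl⟩, ?_⟩
  · exact not_not.1 fun h => hG.2 A hA (entails_empty_iff.2 h)
  · rw [← Finset.coe_insert, Finset.insert_erase hA]
    exact entails_empty_iff.1 hG.1

theorem Sparse.le_card_formulaVars {k : ℕ} {V : Type*} [DecidableEq V] {L : ℕ}
    {F : Finset (AppliedConstraint k V)} (hF : Sparse L F) (hk : 3 ≤ k)
    (himp : ∀ A ∈ F, ¬ HasImplicateOfLengthAtMost A.1 2) {G : Finset (AppliedConstraint k V)}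
    (hG : MinEntails G ∅) (hGF : G ⊆ F) : L ≤ (formulaVars G).card := by
  have hL : L < G.card := by
    by_contra! h
    simpa using hF.lt_two_mul_card hk himp hG hGF hG.nonempty h
  rcases Nat.eq_zero_or_pos L with rfl | hL0
  · exact Nat.zero_le _
  -- Sparsity says nothing about `G`, which is too large; a subformula with exactly `L` constraints
  -- already has at least `L` variables.
  obtain ⟨H, hHG, hH⟩ := Finset.exists_subset_card_eq hL.le
  have h1 := hF H (hHG.trans hGF) (Finset.card_pos.1 (by omega)) hH.le
  have h2 : (formulaVars H).card ≤ (formulaVars G).card :=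
    Finset.card_le_card (Finset.biUnion_subset_biUnion_of_subset_left _ hHG)
  rw [hH] at h1
  have h3 : 4 * L ≤ (4 * k - 5) * L := Nat.mul_le_mul_right _ (by omega)
  omega

theorem tendsto_one_of_one_sub_le {f g : ℕ → ℝ} (hf : Tendsto f atTop (𝓝 0))
    (h1 : ∀ᶠ n in atTop, 1 - f n ≤ g n) (h2 : ∀ᶠ n in atTop, g n ≤ 1) :
    Tendsto g atTop (𝓝 1) :=
  tendsto_of_tendsto_of_tendsto_of_le_of_le' (by simpa using hf.const_sub 1)
    tendsto_const_nhds h1 h2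

theorem eventually_le_mul_natCast {σ : ℝ} (hσ : 0 < σ) (x : ℝ) :
    ∀ᶠ n : ℕ in atTop, x ≤ σ * n :=
  (tendsto_natCast_atTop_atTop.const_mul_atTop hσ).eventually_ge_atTop x

theorem hasFirstOrderPhaseTransition {k : ℕ} {P : PMF (Constraint k)} (hk : 3 ≤ k)
    (hconst : ∀ b : Bool, ∃ C ∈ P.support, (fun _ => b) ∉ C.1)
    (himp : ∀ C ∈ P.support, ¬ HasImplicateOfLengthAtMost C 2) :
    HasFirstOrderPhaseTransition P := by
  obtain ⟨D, hD0, hD⟩ := exists_prob_satisfiable_le hconst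
  obtain ⟨σ, hσ, -, f, hf, hsp⟩ := exists_prob_not_sparse_le P hk
    (c := D) (by exact_mod_cast hD0)
  -- The factor 1/2 absorbs the rounding of ⌊σn⌋ once σn ≥ 2.
  refine ⟨σ / 2, by positivity, fun M hM => ?_⟩
  have hlim : Tendsto (fun n => f n + ((1 / 2 : ℝ) ^ n + probSat P n (M n))) atTop (𝓝 0) := by
    have h1 : Tendsto (fun n : ℕ => (1 / 2 : ℝ) ^ n) atTop (𝓝 0) :=
      tendsto_pow_atTop_nhds_zero_of_lt_one (by norm_num) (by norm_num)
    simpa using hf.add (h1.add hM)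
  refine tendsto_one_of_one_sub_le hlim ?_
    ((eventually_ge_atTop k).mono fun n hn => prob_le_one hn _)
  filter_upwards [eventually_ge_atTop (4 * k), eventually_le_mul_natCast hσ 2] with n hn hσn
  have hkn : k ≤ n := by omega
  have hn0 : (0 : ℝ) < n := by exact_mod_cast (by omega : 0 < n)
  -- The indices in `J` give a formula of bounded density that is still unsatisfiable w.h.p.: by
  -- assumption if `J` is everything, by the first moment bound otherwise.
  obtain ⟨J, hJ1, hJ2⟩ : ∃ J : Finset (Fin (M n)), J.card ≤ D * n ∧
      (J = Finset.univ ∨ D * n ≤ J.card) := by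
    rcases le_total (M n) (D * n) with h | h
    · exact ⟨Finset.univ, by simpa using h, Or.inl rfl⟩
    · obtain ⟨J, -, hJ⟩ := Finset.exists_subset_card_eq
        (s := (Finset.univ : Finset (Fin (M n)))) (n := D * n) (by simpa using h)
      exact ⟨J, hJ.le, Or.inr hJ.ge⟩
  set E₁ := {Φ : Fin (M n) → AppliedConstraint k (Fin n) | ¬ Sparse ⌊σ * n⌋₊ (J.image Φ)}
  set E₂ := {Φ : Fin (M n) → AppliedConstraint k (Fin n) |
    Satisfiable (J.image Φ : Set (AppliedConstraint k (Fin n)))}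
  have h1 : prob P n (M n) E₁ ≤ f n := hsp n (M n) J (by exact_mod_cast hJ1)
  have h2 : prob P n (M n) E₂ ≤ (1 / 2) ^ n + probSat P n (M n) := by
    rcases hJ2 with rfl | hJ2
    · have : E₂ = {Φ | Satisfiable (Set.range Φ)} := by simp [E₂]
      rw [this]
      exact le_add_of_nonneg_left (by positivity)
    · exact (hD n hn (M n) J hJ2).trans (le_add_of_nonneg_right (prob_nonneg _))
  refine le_trans ?_ (one_sub_prob_le (E := E₁ ∪ E₂) hkn fun Φ hΦ hs => ?_)
  · have := prob_union_le (P := P) E₁ E₂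
    linarith
  · have hsparse : Sparse ⌊σ * n⌋₊ (J.image Φ) := not_not.1 fun h => hΦ (Or.inl h)
    obtain ⟨G, hG, hGm⟩ := exists_minEntails_empty_subset fun h => hΦ (Or.inr h)
    have hsupp : ∀ A ∈ J.image Φ, A.1 ∈ P.support := by
      intro A hA
      obtain ⟨i, -, rfl⟩ := Finset.mem_image.1 hA
      exact hs i
    have h3 := hsparse.le_card_formulaVars hk (fun A hA => himp _ (hsupp A hA)) hGm hG
    have h4 : (formulaVars G : Set (Fin n)) ⊆ spine P (Set.range Φ) := by
      refine hGm.formulaVars_subset_spine (fun A hA => ?_) fun A hA => hsupp A (hG hA)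
      obtain ⟨i, -, rfl⟩ := Finset.mem_image.1 (hG hA)
      exact ⟨i, rfl⟩
    have h5 := Set.ncard_le_ncard h4
    rw [Set.ncard_coe_finset] at h5
    have h6 : ((⌊σ * n⌋₊ : ℕ) : ℝ) ≤ (spine P (Set.range Φ)).ncard := by
      exact_mod_cast h3.trans h5
    have h7 := Nat.lt_floor_add_one (σ * n)
    rw [Set.mem_ofPred_eq, le_div_iff₀ hn0]
    linarith

/-! ### Resolution lower bounds -/

section Resolution

variable {k : ℕ} {cnf : Constraint k → Finset (Clause (Fin k))}

theorem Sparse.le_resolutionWidth {V : Type*} [DecidableEq V] {s w x : ℕ}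
    {F : Finset (AppliedConstraint k V)} (hF : Sparse (2 * s) F) (hk : 3 ≤ k)
    (himp : ∀ A ∈ F, ¬ HasImplicateOfLengthAtMost A.1 2) (hs : 0 < s) (hw : 2 * w ≤ s)
    (hcnf : IsCNFConversion cnf) (hx : x ≤ w + 1) :
    (x : ℕ∞) ≤ resolutionWidth (cnfClauses cnf (F : Set (AppliedConstraint k V))) := by
  refine le_iInf₂ fun π hπ => ?_
  by_contra! hlt
  refine hF.not_widthDerivable hk himp hs hw (fun c hc => exists_entails_of_mem_cnfClauses hcnf hc)
    (hπ.widthDerivable_of_card_le fun c hc => ?_)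
  have : (c.card : ℕ∞) < x :=
    (le_iSup₂ (f := fun (c : Clause V) (_ : c ∈ π) => (c.card : ℕ∞)) c hc).trans_lt hlt
  have : c.card < x := by exact_mod_cast this
  omega

theorem Sparse.le_resolutionComplexity {V : Type*} [DecidableEq V] [Fintype V] {s d x : ℕ}
    {F : Finset (AppliedConstraint k V)} (hF : Sparse (2 * s) F) (hk : 3 ≤ k)
    (himp : ∀ A ∈ F, ¬ HasImplicateOfLengthAtMost A.1 2) (hs : 0 < s) (hd : 4 * d ≤ s)
    (hkd : 2 * k ≤ d) (hdV : d ≤ 2 * Fintype.card V) (hV : 0 < Fintype.card V)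
    (hcnf : IsCNFConversion cnf) (hx : x ≤ ⌈Real.exp (d * d / (2 * Fintype.card V))⌉₊) :
    (x : ℕ∞) ≤ resolutionComplexity (cnfClauses cnf (F : Set (AppliedConstraint k V))) := by
  refine le_iInf₂ fun π hπ => ?_
  have h := hπ.le_length (d := d) (b := d) (fun c hc => (card_le_of_mem_cnfClauses hc).trans hkd)
    hV hdV (hF.not_widthDerivable hk himp hs (by omega)
      fun c hc => exists_entails_of_mem_cnfClauses hcnf hc)
  exact_mod_cast hx.trans (Nat.ceil_le.2 h)

theorem Sparse.mono {V : Type*} [DecidableEq V] {L L' : ℕ} {F : Finset (AppliedConstraint k V)}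
    (hF : Sparse L F) (h : L' ≤ L) : Sparse L' F :=
  fun G hG hne hc => hF G hG hne (hc.trans h)

theorem ofReal_le_toENNReal {x : ℝ} {y : ℕ∞} (h : ((⌈x⌉₊ : ℕ) : ℕ∞) ≤ y) :
    ENNReal.ofReal x ≤ (y : ℝ≥0∞) := by
  calc ENNReal.ofReal x ≤ ENNReal.ofReal (⌈x⌉₊ : ℕ) := ENNReal.ofReal_le_ofReal (Nat.le_ceil x)
    _ = (((⌈x⌉₊ : ℕ) : ℕ∞) : ℝ≥0∞) := by simp
    _ ≤ (y : ℝ≥0∞) := ENat.toENNReal_le.2 h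

theorem Sparse.resolution_bounds {n : ℕ} {σ : ℝ} (hσ : 0 < σ) (hσ1 : σ ≤ 1)
    (hn : 16 + 32 * k ≤ σ * n) {F : Finset (AppliedConstraint k (Fin n))}
    (hF : Sparse ⌊σ * n⌋₊ F) (hk : 3 ≤ k)
    (himp : ∀ A ∈ F, ¬ HasImplicateOfLengthAtMost A.1 2) (hcnf : IsCNFConversion cnf) :
    ENNReal.ofReal (σ ^ 2 / 512 * n) ≤
      (resolutionWidth (cnfClauses cnf (F : Set (AppliedConstraint k (Fin n)))) : ℝ≥0∞) ∧
    ENNReal.ofReal ((2 : ℝ) ^ (σ ^ 2 / 512 * n)) ≤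
      (resolutionComplexity (cnfClauses cnf (F : Set (AppliedConstraint k (Fin n)))) : ℝ≥0∞) := by
  set L := ⌊σ * n⌋₊ with hL
  have hn0 : (0 : ℝ) ≤ n := Nat.cast_nonneg n
  have hk0 : (0 : ℝ) ≤ k := Nat.cast_nonneg k
  have hLn : (L : ℝ) ≤ σ * n := Nat.floor_le (by positivity)
  have hnL : σ * n < L + 1 := Nat.lt_floor_add_one _
  have hσn : σ * n ≤ n := mul_le_of_le_one_left hn0 hσ1
  have hLn' : L ≤ n := by exact_mod_cast hLn.trans hσn
  have hL16 : 16 + 32 * k ≤ L := by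
    have : (16 + 32 * k : ℕ) ≤ L := Nat.le_floor (by exact_mod_cast hn)
    exact this
  -- With s = `L / 2` this gives 2(d + d) ≤ s, as needed for the tradeoff with b = d. The lower
  -- bound on σn ensures d ≥ σn/16 and d ≥ 2k.
  set d := L / 8 with hd
  have hdL : (L : ℝ) ≤ 8 * d + 7 := by exact_mod_cast (by omega : L ≤ 8 * d + 7)
  have hdσ : σ * n / 16 ≤ d := by linarith
  have hn1 : (0 : ℝ) < n := by exact_mod_cast (by omega : 0 < n)
  have hF' : Sparse (2 * (L / 2)) F := hF.mono (by omega)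
  have hσ2 : σ ^ 2 / 512 * n ≤ d := by
    have : σ ^ 2 * n ≤ σ * n := by nlinarith
    linarith [mul_nonneg hσ.le hn0]
  constructor
  · refine ofReal_le_toENNReal (hF'.le_resolutionWidth (w := d) hk himp (by omega) (by omega)
      hcnf ?_)
    exact (Nat.ceil_le.2 hσ2).trans (Nat.le_succ _)
  · refine ofReal_le_toENNReal (hF'.le_resolutionComplexity (d := d) hk himp (by omega) (by omega)
      (by omega) (by rw [Fintype.card_fin]; omega) (by rw [Fintype.card_fin]; omega) hcnf ?_)
    refine Nat.ceil_le_ceil ?_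
    rw [Fintype.card_fin, Real.rpow_def_of_pos two_pos]
    refine Real.exp_le_exp.2 ?_
    have h1 : Real.log 2 * (σ ^ 2 / 512 * n) ≤ 1 * (σ ^ 2 / 512 * n) := by
      gcongr
      linarith [Real.log_two_lt_d9]
    -- The constant is 512 = 2·16², from d ≥ σn/16.
    have h2 : σ ^ 2 / 512 * n ≤ d * d / (2 * n) := by
      rw [le_div_iff₀ (by positivity)]
      have := mul_self_le_mul_self (by positivity) hdσ
      nlinarith
    linarith

theorem exists_resolution_bounds {P : PMF (Constraint k)} (hk : 3 ≤ k)
    (himp : ∀ C ∈ P.support, ¬ HasImplicateOfLengthAtMost C 2) (hcnf : IsCNFConversion cnf)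
    {c : ℝ} (hc : 0 < c) : ∃ δ : ℝ, 0 < δ ∧ ∀ M : ℕ → ℕ, (∀ n : ℕ, (M n : ℝ) ≤ c * n) →
      Tendsto (fun n : ℕ => prob P n (M n)
        {Φ | ENNReal.ofReal (δ * n) ≤
          (resolutionWidth (cnfClauses cnf (Set.range Φ)) : ℝ≥0∞)}) atTop (𝓝 1) ∧
      Tendsto (fun n : ℕ => prob P n (M n)
        {Φ | ENNReal.ofReal ((2 : ℝ) ^ (δ * n)) ≤
          (resolutionComplexity (cnfClauses cnf (Set.range Φ)) : ℝ≥0∞)}) atTop (𝓝 1) := by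
  obtain ⟨σ, hσ, hσ1, f, hf, hsp⟩ := exists_prob_not_sparse_le P hk hc
  refine ⟨σ ^ 2 / 512, by positivity, fun M hM => ?_⟩
  have key : ∀ E : ∀ n, Set (Fin (M n) → AppliedConstraint k (Fin n)),
      (∀ n : ℕ, 16 + 32 * (k : ℝ) ≤ σ * n → ∀ Φ : Fin (M n) → AppliedConstraint k (Fin n),
        (∀ i, (Φ i).1 ∈ P.support) → Sparse ⌊σ * n⌋₊ (Finset.univ.image Φ) → Φ ∈ E n) →
      Tendsto (fun n => prob P n (M n) (E n)) atTop (𝓝 1) := by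
    intro E hE
    refine tendsto_one_of_one_sub_le hf ?_
      ((eventually_ge_atTop k).mono fun n hn => prob_le_one hn _)
    filter_upwards [eventually_ge_atTop k, eventually_le_mul_natCast hσ (16 + 32 * k)]
      with n hkn hn
    refine le_trans ?_ (one_sub_prob_le (E := {Φ | ¬ Sparse ⌊σ * n⌋₊ (Finset.univ.image Φ)})
      hkn fun Φ hΦ hs => hE n hn Φ hs (not_not.1 hΦ))
    have := hsp n (M n) Finset.univ (by simpa using hM n)
    linarith
  have bounds : ∀ n : ℕ, 16 + 32 * (k : ℝ) ≤ σ * n →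
      ∀ Φ : Fin (M n) → AppliedConstraint k (Fin n), (∀ i, (Φ i).1 ∈ P.support) →
      Sparse ⌊σ * n⌋₊ (Finset.univ.image Φ) → _ := fun n hn Φ hs hΦ =>
    hΦ.resolution_bounds (cnf := cnf) hσ hσ1 hn hk (fun A hA => by
      obtain ⟨i, -, rfl⟩ := Finset.mem_image.1 hA
      exact himp _ (hs i)) hcnf
  simp only [Finset.coe_image, Finset.coe_univ, Set.image_univ] at bounds
  exact ⟨key _ fun n hn Φ hs hΦ => (bounds n hn Φ hs hΦ).1,
    key _ fun n hn Φ hs hΦ => (bounds n hn Φ hs hΦ).2⟩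

end Resolution

end RandomSat

open RandomSat

theorem mainTheorem3 {k : ℕ} (P : PMF (Constraint k)) (hsharp : HasSharpThreshold P)
    (himp : ∀ C ∈ P.support, ¬ HasImplicateOfLengthAtMost C 2) :
    -- the density bound for minimally unsatisfiable formulas
    (∀ (V : Type*) [DecidableEq V] (F : Finset (AppliedConstraint k V)),
      (∀ A ∈ F, A.1 ∈ P.support) → MinimallyUnsatisfiable F →
        2 / (2 * (k : ℝ) - 3) ≤ cStar F) ∧
    -- the sufficient condition for a first-order phase transition
    (∃ ε : ℝ, 0 < ε ∧ ∀ (V : Type*) [DecidableEq V] (F : Finset (AppliedConstraint k V)),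
      (∀ A ∈ F, A.1 ∈ P.support) → MinimallyUnsatisfiable F →
        (1 + ε) / ((k : ℝ) - 1) < cStar F) ∧
    HasFirstOrderPhaseTransition P ∧
    -- linear resolution width and exponential resolution complexity
    (∀ cnf : Constraint k → Finset (Clause (Fin k)), IsCNFConversion cnf →
      ∀ c : ℝ, 0 < c → ∃ δ : ℝ, 0 < δ ∧ ∀ M : ℕ → ℕ, (∀ n : ℕ, (M n : ℝ) ≤ c * n) →
        Tendsto (fun n : ℕ => prob P n (M n)
          {Φ | ENNReal.ofReal (δ * n) ≤
            (resolutionWidth (cnfClauses cnf (Set.range Φ)) : ℝ≥0∞)}) atTop (𝓝 1) ∧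
        Tendsto (fun n : ℕ => prob P n (M n)
          {Φ | ENNReal.ofReal ((2 : ℝ) ^ (δ * n)) ≤
            (resolutionComplexity (cnfClauses cnf (Set.range Φ)) : ℝ≥0∞)}) atTop (𝓝 1)) := by
  have hconst := hsharp.exists_const_notMem
  obtain ⟨C, hC, hb⟩ := hconst true
  have hk := three_le_of_exists_notMem hb (himp C hC)
  refine ⟨fun V _ F hF hm => le_cStar_of_minimallyUnsatisfiable hm fun A hA => himp _ (hF A hA),
    ⟨1 / (2 * k + 1), by positivity, fun V _ F hF hm =>
      lt_cStar_of_minimallyUnsatisfiable hm fun A hA => himp _ (hF A hA)⟩,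
    hasFirstOrderPhaseTransition hk hconst himp, fun cnf hcnf c hc =>
      exists_resolution_bounds hk himp hcnf hc⟩
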